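/- Let $1\le k<n$ and let $N=\mathbb Z^{k(n-k)}$ have basis $f_{i,j}$ ($1\le i\le k$, $1\le j\le n-k$). Put $u_{1,0}=f_{1,1}$, $u_{i,j}=f_{i,j+1}-f_{i-1,j+1}$ ($2\le i\le k$, $0\le j\le n-k-1$), $v_{i,j}=f_{i,j+1}-f_{i,j}$ ($1\le i\le k$, $1\le j\le n-k-1$) and $v_{k,n-k}=-f_{k,n-k}$. Let $\Delta(k,n)\subset N_{\mathbb R}$ be the convex hull of all these vectors, and let $P(k,n)$ be the complex toric variety of the fan of cones over the proper faces of $\Delta(k,n)$. Put $$E_1=\{u_{1,0}\},\qquad E_i=\{u_{i,0},\dots,u_{i,n-k-1}\}\ (2\le i\le k),$$ $$E_{k+j}=\{v_{1,j},\dots,v_{k,j}\}\ (1\le j\le n-k-1),\qquad E_n=\{v_{k,n-k}\},$$ and let $D(E_i)$ be the reduced torus-invariant Weil divisor on $P(k,n)$ whose irreducible components are the torus-invariant prime divisors corresponding to the elements of $E_i$. Then for every $i=1,\dots,n$ the divisor $D(E_i)$ is Cartier and ample, and $\mathrm{Pic}(P(k,n))$ is infinite cyclic, generated by the class of $D(E_i)$.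 In particular the divisors $D(E_1),\dots,D(E_n)$ are all linearly equivalent. -/

import Mathlib

open CategoryTheory CategoryTheory.Limits AlgebraicGeometry

noncomputable section

/-! ### Divisors on integral locally Noetherian schemes -/

namespace DivisorTheory

open AlgebraicGeometry.Scheme

variable (X : Scheme.{0}) [IsIntegral X] [IsLocallyNoetherian X]

/-- The principal divisors `div f`, for `f` a nonzero rational function. A prime divisor is
represented by its generic point, a point of codimension one, and a divisor is the function that
sends this point to the coefficient and all other points of `X` to `0`. -/
def principalDivisors : AddSubgroup (AlgebraicCycle X ℤ) where
  carrier := {D | ∃ f : X.functionField, f ≠ 0 ∧ ∀ y : X, D y = ord f y}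
  zero_mem' := by
    refine ⟨1, one_ne_zero, fun y => ?_⟩
    have h : ord (1 * 1 : X.functionField) y = _ := ord_mul one_ne_zero one_ne_zero
    rw [mul_one] at h
    have h0 : (0 : AlgebraicCycle X ℤ) y = 0 := rfl
    omega
  add_mem' := by
    rintro D D' ⟨f, hf, hD⟩ ⟨g, hg, hD'⟩
    refine ⟨f * g, mul_ne_zero hf hg, fun y => ?_⟩
    have h0 : (D + D') y = D y + D' y := rfl
    rw [h0, ord_mul hf hg, hD, hD']
  neg_mem' := by
    rintro D ⟨f, hf, hD⟩
    refine ⟨f⁻¹, inv_ne_zero hf, fun y => ?_⟩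
    have h : ord (1 * 1 : X.functionField) y = _ := ord_mul one_ne_zero one_ne_zero
    have h' := ord_mul (x := y) hf (inv_ne_zero hf)
    rw [mul_inv_cancel₀ hf] at h'
    rw [mul_one] at h
    have h0 : (-D) y = -(D y) := rfl
    have := hD y
    omega

/-- The locally principal divisors: on a normal scheme these are the Cartier divisors. -/
def cartierDivisors : AddSubgroup (AlgebraicCycle X ℤ) where
  carrier := {D | ∀ x : X, ∃ U : X.Opens, x ∈ U ∧
    ∃ f : X.functionField, f ≠ 0 ∧ ∀ y ∈ U, D y = ord f y}
  zero_mem' := fun x => by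
    obtain ⟨f, hf, h⟩ := (principalDivisors X).zero_mem
    exact ⟨⊤, trivial, f, hf, fun y _ => h y⟩
  add_mem' := by
    intro D D' h h' x
    obtain ⟨U, hU, f, hf, hD⟩ := h x
    obtain ⟨U', hU', g, hg, hD'⟩ := h' x
    refine ⟨U ⊓ U', ⟨hU, hU'⟩, f * g, mul_ne_zero hf hg, fun y hy => ?_⟩
    have h0 : (D + D') y = D y + D' y := rfl
    rw [h0, ord_mul hf hg, hD y hy.1, hD' y hy.2]
  neg_mem' := by
    intro D h x
    obtain ⟨U, hU, f, hf, hD⟩ := h x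
    refine ⟨U, hU, f⁻¹, inv_ne_zero hf, fun y hy => ?_⟩
    have h : ord (1 * 1 : X.functionField) y = _ := ord_mul one_ne_zero one_ne_zero
    have h' := ord_mul (x := y) hf (inv_ne_zero hf)
    rw [mul_inv_cancel₀ hf] at h'
    rw [mul_one] at h
    have h0 : (-D) y = -(D y) := rfl
    have := hD y hy
    omega

/-- The Picard group of a normal integral locally Noetherian scheme:
Cartier divisors modulo linear equivalence. -/
abbrev Pic : Type :=
  cartierDivisors X ⧸ (principalDivisors X).addSubgroupOf (cartierDivisors X)

variable {X}

/-- The class of a Cartier divisor in the Picard group. -/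
def Pic.cls (D : cartierDivisors X) : Pic X := QuotientAddGroup.mk D

/-- Linear equivalence of divisors. -/
def LinearlyEquivalent (D D' : AlgebraicCycle X ℤ) : Prop := D - D' ∈ principalDivisors X

/-- A Cartier divisor `D` on `X` is ample if `X` is quasi-compact and every point `x` of `X` has a
neighbourhood of the form `X_s` that is affine, for some section `s` of `𝒪(m D)` with `m ≥ 1`.
Here a nonzero section `s` is a rational function `f ≠ 0` with `div f + m D ≥ 0`, and `X_s` is the
complement of the support of the effective divisor `div f + m D`. -/
def IsAmple (D : cartierDivisors X) : Prop :=
  CompactSpace X ∧ ∀ x : X, ∃ m : ℕ, 0 < m ∧ ∃ f : X.functionField, f ≠ 0 ∧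
    (∀ y : X, 0 ≤ ord f y + m * D.1 y) ∧
    ∃ U : X.Opens, x ∈ U ∧ IsAffineOpen U ∧
      ∀ z : X, z ∈ U ↔ ∀ y : X, y ⤳ z → ord f y + m * D.1 y = 0

end DivisorTheory

/-! ### Toric varieties -/

namespace Toric

variable {ι : Type} [Fintype ι]

/-- The pairing of the lattice `M = ℤ^ι` with `N_ℝ = ℝ^ι`. -/
def pairing (m : ι → ℤ) (x : ι → ℝ) : ℝ := ∑ p, (m p : ℝ) * x p

lemma pairing_add (m m' : ι → ℤ) (x : ι → ℝ) :
    pairing (m + m') x = pairing m x + pairing m' x := by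
  simp [pairing, add_mul, Finset.sum_add_distrib]

lemma pairing_zero (x : ι → ℝ) : pairing (0 : ι → ℤ) x = 0 := by simp [pairing]

lemma pairing_neg (m : ι → ℤ) (x : ι → ℝ) : pairing (-m) x = -pairing m x := by
  simp [pairing]

lemma pairing_nsmul (N : ℕ) (m : ι → ℤ) (x : ι → ℝ) :
    pairing (N • m) x = N * pairing m x := by
  simp [pairing, Finset.mul_sum, mul_assoc]

/-- The monoid `σ^∨ ∩ M` of lattice points of the dual cone. -/
def dualMonoid (σ : PointedCone ℝ (ι → ℝ)) : AddSubmonoid (ι → ℤ) where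
  carrier := {m | ∀ x ∈ σ, 0 ≤ pairing m x}
  zero_mem' := fun x _ => by rw [pairing_zero]
  add_mem' := fun h h' x hx => by
    rw [pairing_add]; exact add_nonneg (h x hx) (h' x hx)

lemma dualMonoid_anti {σ τ : PointedCone ℝ (ι → ℝ)} (h : σ ≤ τ) :
    dualMonoid τ ≤ dualMonoid σ := fun _ hm x hx => hm x (h hx)

/-- The coordinate ring `ℂ[σ^∨ ∩ M]` of the affine toric variety of the cone `σ`. -/
abbrev chartRing (σ : PointedCone ℝ (ι → ℝ)) : Type := AddMonoidAlgebra ℂ (dualMonoid σ)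

/-- The inclusion `ℂ[τ^∨ ∩ M] ⊆ ℂ[σ^∨ ∩ M]` for `σ ⊆ τ`. -/
def chartMap {σ τ : PointedCone ℝ (ι → ℝ)} (h : σ ≤ τ) : chartRing τ →+* chartRing σ :=
  AddMonoidAlgebra.mapDomainRingHom ℂ (AddSubmonoid.inclusion (dualMonoid_anti h))

lemma chartMap_single {σ τ : PointedCone ℝ (ι → ℝ)} (h : σ ≤ τ) (a : dualMonoid τ) (c : ℂ) :
    chartMap h (AddMonoidAlgebra.single a c) =
      AddMonoidAlgebra.single (AddSubmonoid.inclusion (dualMonoid_anti h) a) c := by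
  simp [chartMap]

lemma chartMap_refl (σ : PointedCone ℝ (ι → ℝ)) : chartMap (le_refl σ) = RingHom.id _ :=
  AddMonoidAlgebra.mapDomainRingHom_id

lemma chartMap_comp {σ τ ρ : PointedCone ℝ (ι → ℝ)} (h : σ ≤ τ) (h' : τ ≤ ρ) :
    (chartMap h).comp (chartMap h') = chartMap (h.trans h') :=
  (AddMonoidAlgebra.mapDomainRingHom_comp _ _).symm

lemma chartMap_injective {σ τ : PointedCone ℝ (ι → ℝ)} (h : σ ≤ τ) :
    Function.Injective (chartMap h) :=
  AddMonoidAlgebra.mapDomain_injective (AddSubmonoid.inclusion_injective _)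

/-- The affine toric varieties `Spec ℂ[σ^∨ ∩ M]` of the cones of a fan, with the morphisms
between them given by the inclusions of cones. -/
def chartDiagram (F : Set (PointedCone ℝ (ι → ℝ))) : F ⥤ Scheme.{0} where
  obj σ := Spec (CommRingCat.of (chartRing σ.1))
  map {σ τ} h := Spec.map (CommRingCat.ofHom (chartMap (σ := σ.1) (τ := τ.1) (leOfHom h)))
  map_id σ := by
    rw [chartMap_refl]
    exact Spec.map_id _
  map_comp {σ τ ρ} h h' := by
    rw [← Spec.map_comp, ← CommRingCat.ofHom_comp, chartMap_comp]

/-- The lattice point `m` cuts out `σ` as a face of `τ`, and `σ^∨ ∩ M = (τ^∨ ∩ M) - ℕ m`. -/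
structure CutsOut (m : ι → ℤ) (σ τ : PointedCone ℝ (ι → ℝ)) : Prop where
  le : σ ≤ τ
  mem : m ∈ dualMonoid τ
  neg_mem : -m ∈ dualMonoid σ
  exists_add : ∀ b ∈ dualMonoid σ, ∃ N : ℕ, b + N • m ∈ dualMonoid τ

/-- The regular function on the chart of `τ` given by the character `m`. -/
def chr {τ : PointedCone ℝ (ι → ℝ)} (m : ι → ℤ) (hm : m ∈ dualMonoid τ) : chartRing τ :=
  AddMonoidAlgebra.single ⟨m, hm⟩ 1

lemma chr_pow {τ : PointedCone ℝ (ι → ℝ)} {m : ι → ℤ} (hm : m ∈ dualMonoid τ) (N : ℕ) :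
    chr m hm ^ N = chr (N • m) (nsmul_mem hm N) := by
  simp [chr, AddMonoidAlgebra.single_pow]

lemma chr_mul {τ : PointedCone ℝ (ι → ℝ)} {m m' : ι → ℤ} (hm : m ∈ dualMonoid τ)
    (hm' : m' ∈ dualMonoid τ) :
    chr m hm * chr m' hm' = chr (m + m') (add_mem hm hm') := by
  simp [chr, AddMonoidAlgebra.single_mul_single]

lemma chartMap_chr {σ τ : PointedCone ℝ (ι → ℝ)} (h : σ ≤ τ) {m : ι → ℤ}
    (hm : m ∈ dualMonoid τ) : chartMap h (chr m hm) = chr m (dualMonoid_anti h hm) :=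
  chartMap_single h _ _

lemma CutsOut.isLocalization {m : ι → ℤ} {σ τ : PointedCone ℝ (ι → ℝ)} (h : CutsOut m σ τ) :
    @IsLocalization.Away _ _ (chr m h.mem) (chartRing σ) _ (chartMap h.le).toAlgebra := by
  let _ := (chartMap h.le).toAlgebra
  have hu : IsUnit (chartMap h.le (chr m h.mem)) := by
    refine IsUnit.of_mul_eq_one (chr (-m) h.neg_mem) ?_
    rw [chartMap_chr, chr_mul]
    simp only [add_neg_cancel]
    rfl
  refine (isLocalization_iff _ _).2 ⟨?_, ?_, ?_⟩
  · rintro ⟨_, N, rfl⟩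
    change IsUnit (chartMap h.le (chr m h.mem ^ N))
    rw [map_pow]
    exact hu.pow N
  · intro z
    suffices H : ∃ N : ℕ, ∃ r : chartRing τ, z * chartMap h.le (chr m h.mem ^ N) =
        chartMap h.le r by
      obtain ⟨N, r, hr⟩ := H
      exact ⟨⟨r, ⟨_, N, rfl⟩⟩, hr⟩
    induction z using AddMonoidAlgebra.induction_linear with
    | zero => exact ⟨0, 0, by simp⟩
    | add f g hf hg =>
      obtain ⟨N, r, hr⟩ := hf
      obtain ⟨N', r', hr'⟩ := hg
      refine ⟨N + N', r * chr m h.mem ^ N' + r' * chr m h.mem ^ N, ?_⟩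
      rw [map_add, map_mul, map_mul, ← hr, ← hr', pow_add, map_mul]
      ring
    | single a c =>
      obtain ⟨N, hN⟩ := h.exists_add a.1 a.2
      refine ⟨N, AddMonoidAlgebra.single ⟨_, hN⟩ c, ?_⟩
      rw [chr_pow, chartMap_chr, chartMap_single, chr, AddMonoidAlgebra.single_mul_single, mul_one]
      rfl
  · intro x y hxy
    exact ⟨1, by rw [chartMap_injective h.le hxy]⟩

lemma CutsOut.isOpenImmersion {m : ι → ℤ} {σ τ : PointedCone ℝ (ι → ℝ)} (h : CutsOut m σ τ) :
    IsOpenImmersion (Spec.map (CommRingCat.ofHom (chartMap h.le))) := by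
  let _ := (chartMap h.le).toAlgebra
  have := h.isLocalization
  exact IsOpenImmersion.of_isLocalization (chr m h.mem)

lemma CutsOut.exists_preimage {m : ι → ℤ} {σ τ : PointedCone ℝ (ι → ℝ)} (h : CutsOut m σ τ)
    (p : PrimeSpectrum (chartRing τ)) (hp : chr m h.mem ∉ p.asIdeal) :
    ∃ q : PrimeSpectrum (chartRing σ), PrimeSpectrum.comap (chartMap h.le) q = p := by
  let _ := (chartMap h.le).toAlgebra
  have := h.isLocalization
  have := PrimeSpectrum.localization_away_comap_range (chartRing σ) (chr m h.mem)
  have hp' : p ∈ (PrimeSpectrum.basicOpen (chr m h.mem) : Set (PrimeSpectrum (chartRing τ))) := hp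
  rw [← this] at hp'
  exact hp'

lemma CutsOut.notMem {m : ι → ℤ} {σ τ : PointedCone ℝ (ι → ℝ)} (h : CutsOut m σ τ)
    (q : PrimeSpectrum (chartRing σ)) :
    chr m h.mem ∉ (PrimeSpectrum.comap (chartMap h.le) q).asIdeal := by
  let _ := (chartMap h.le).toAlgebra
  have := h.isLocalization
  have := PrimeSpectrum.localization_away_comap_range (chartRing σ) (chr m h.mem)
  have hq : PrimeSpectrum.comap (chartMap h.le) q ∈
      (PrimeSpectrum.basicOpen (chr m h.mem) : Set (PrimeSpectrum (chartRing τ))) := by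
    rw [← this]
    exact ⟨q, rfl⟩
  exact hq

/-- Any two cones of `F` that lie in a third one are cut out of it as faces, and their
intersection is cut out by the sum of the two lattice points. -/
def IsGluable (F : Set (PointedCone ℝ (ι → ℝ))) : Prop :=
  ∀ σ ∈ F, ∀ σ' ∈ F, ∀ τ ∈ F, σ ≤ τ → σ' ≤ τ → ∃ m m' : ι → ℤ,
    CutsOut m σ τ ∧ CutsOut m' σ' τ ∧ ∃ ρ ∈ F, ρ ≤ σ ∧ ρ ≤ σ' ∧ CutsOut (m + m') ρ τ

lemma IsGluable.isOpenImmersion {F : Set (PointedCone ℝ (ι → ℝ))} (hF : IsGluable F)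
    {σ τ : F} (h : σ ⟶ τ) : IsOpenImmersion ((chartDiagram F).map h) := by
  obtain ⟨m, _, hm, _⟩ := hF σ.1 σ.2 σ.1 σ.2 τ.1 τ.2 (leOfHom h) (leOfHom h)
  exact hm.isOpenImmersion

lemma IsGluable.isLocallyDirected {F : Set (PointedCone ℝ (ι → ℝ))} (hF : IsGluable F) :
    (chartDiagram F ⋙ Scheme.forget).IsLocallyDirected := by
  constructor
  intro σ σ' τ h h' x x' hx
  obtain ⟨m, m', hm, hm', ρ, hρ, hρσ, hρσ', hmm⟩ :=
    hF σ.1 σ.2 σ'.1 σ'.2 τ.1 τ.2 (leOfHom h) (leOfHom h')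
  have hx' : PrimeSpectrum.comap (chartMap hm.le) x = PrimeSpectrum.comap (chartMap hm'.le) x' := hx
  have h1 := hm.notMem x
  have h2 := hm'.notMem x'
  rw [← hx'] at h2
  obtain ⟨q, hq⟩ := hmm.exists_preimage (PrimeSpectrum.comap (chartMap hm.le) x) (by
    have := (PrimeSpectrum.comap (chartMap hm.le) x).2.mul_notMem h1 h2
    rwa [chr_mul] at this)
  have := hF.isOpenImmersion h
  have := hF.isOpenImmersion h'
  refine ⟨⟨ρ, hρ⟩, homOfLE hρσ, homOfLE hρσ', q, ?_, ?_⟩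
  · apply ((chartDiagram F).map h).isOpenEmbedding.injective
    refine Eq.trans ?_ hq
    change PrimeSpectrum.comap (chartMap hm.le) (PrimeSpectrum.comap (chartMap hρσ) q) =
      PrimeSpectrum.comap (chartMap hmm.le) q
    rw [← PrimeSpectrum.comap_comp_apply, chartMap_comp]
  · apply ((chartDiagram F).map h').isOpenEmbedding.injective
    refine Eq.trans ?_ (hq.trans hx)
    change PrimeSpectrum.comap (chartMap hm'.le) (PrimeSpectrum.comap (chartMap hρσ') q) =
      PrimeSpectrum.comap (chartMap hmm.le) q
    rw [← PrimeSpectrum.comap_comp_apply, chartMap_comp]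

lemma IsGluable.hasColimit {F : Set (PointedCone ℝ (ι → ℝ))} (hF : IsGluable F) :
    HasColimit (chartDiagram F) := by
  have : ∀ {σ τ : F} (h : σ ⟶ τ), IsOpenImmersion ((chartDiagram F).map h) :=
    fun h => hF.isOpenImmersion h
  have := hF.isLocallyDirected
  infer_instance


/-- The toric variety of a fan `F`, glued from the affine toric varieties of its cones. -/
def toricVariety (F : Set (PointedCone ℝ (ι → ℝ))) (hF : IsGluable F) : Scheme.{0} :=
  have := hF.hasColimit
  colimit (chartDiagram F)

/-- The chart `Spec ℂ[σ^∨ ∩ M] ⟶ X_F` of a cone `σ` of the fan `F`. -/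
def chart (F : Set (PointedCone ℝ (ι → ℝ))) (hF : IsGluable F) (σ : F) :
    Spec (CommRingCat.of (chartRing σ.1)) ⟶ toricVariety F hF :=
  have := hF.hasColimit
  colimit.ι (chartDiagram F) σ

/-- The lattice vector `w`, as a vector in `ℝ^ι`. -/
def toReal (w : ι → ℤ) : ι → ℝ := fun p => (w p : ℝ)

/-- The torus invariant prime divisor of the ray spanned by the primitive lattice vector `w`, as a
subset of the toric variety: in the chart of a cone `σ` it is empty unless `w ∈ σ`, and then it is
the common zero set of the characters `m ∈ σ^∨ ∩ M` with `⟨m, w⟩ > 0`. -/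
def rayDivisor (F : Set (PointedCone ℝ (ι → ℝ))) (hF : IsGluable F) (w : ι → ℤ) :
    Set (toricVariety F hF) :=
  ⋃ (σ : F) (_ : toReal w ∈ σ.1), chart F hF σ ''
    {x : PrimeSpectrum (chartRing σ.1) | ∀ (m : ι → ℤ) (hm : m ∈ dualMonoid σ.1),
      0 < pairing m (toReal w) → chr m hm ∈ x.asIdeal}

open Classical in
/-- The reduced divisor `∑_{w ∈ W} D_w`, for a finite set `W` of primitive generators of rays. -/
def reducedDivisor (F : Set (PointedCone ℝ (ι → ℝ))) (hF : IsGluable F) (W : Set (ι → ℤ))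
    (hW : W.Finite) : AlgebraicCycle (toricVariety F hF) ℤ where
  toFun x := if ∃ w ∈ W, IsGenericPoint x (rayDivisor F hF w) then 1 else 0
  supportWithinDomain' := Set.subset_univ _
  supportLocallyFiniteWithinDomain' := by
    intro x _
    refine ⟨Set.univ, Filter.univ_mem, Set.Finite.subset (hW.biUnion (t := fun w =>
      {x | IsGenericPoint x (rayDivisor F hF w)}) fun w _ => ?_) ?_⟩
    · refine Set.Subsingleton.finite fun y hy z hz => ?_
      exact hy.eq hz
    · rintro y ⟨-, hy⟩
      have hy' : ¬ (if ∃ w ∈ W, IsGenericPoint y (rayDivisor F hF w) then (1 : ℤ) else 0) = 0 := hy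
      have h : ∃ w ∈ W, IsGenericPoint y (rayDivisor F hF w) := by
        by_contra h
        exact hy' (if_neg h)
      obtain ⟨w, hw, h⟩ := h
      exact Set.mem_biUnion hw h

end Toric

/-! ### The toric degeneration of the Grassmannian -/

namespace GrassmannianToric

open Toric

/-- The index set of the basis `f_{i,j}`, `1 ≤ i ≤ k`, `1 ≤ j ≤ n - k`, of `N(k,n)`. -/
abbrev Idx (k n : ℕ) : Type := ↥(Finset.Icc 1 k ×ˢ Finset.Icc 1 (n - k))

variable (k n : ℕ)

/-- The basis vector `f_{i,j}` of `N(k,n)`. -/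
def f (i j : ℕ) : Idx k n → ℤ := fun p => if p.1 = (i, j) then 1 else 0

/-- `u_{i,j} = f_{i,j+1} - f_{i-1,j+1}`, used for `2 ≤ i ≤ k` and `0 ≤ j ≤ n-k-1`. -/
def u (i j : ℕ) : Idx k n → ℤ := f k n i (j + 1) - f k n (i - 1) (j + 1)

/-- `v_{i,j} = f_{i,j+1} - f_{i,j}`, used for `1 ≤ i ≤ k` and `1 ≤ j ≤ n-k-1`. -/
def v (i j : ℕ) : Idx k n → ℤ := f k n i (j + 1) - f k n i j

/-- The set of all `u_{i,j}` and `v_{i,j}`, with `u_{1,0} = f_{1,1}` and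
`v_{k,n-k} = - f_{k,n-k}`. -/
def vertexSet : Set (Idx k n → ℤ) :=
  {w | w = f k n 1 1 ∨ (∃ i j, 2 ≤ i ∧ i ≤ k ∧ j < n - k ∧ w = u k n i j) ∨
    (∃ i j, 1 ≤ i ∧ i ≤ k ∧ 1 ≤ j ∧ j < n - k ∧ w = v k n i j) ∨ w = -f k n k (n - k)}

/-- The polytope `Δ(k,n)`. -/
def polytope : Set (Idx k n → ℝ) := convexHull ℝ (toReal '' vertexSet k n)

/-- The fan `Σ(k,n)` of cones over the proper faces of `Δ(k,n)`; the empty face gives `{0}`. -/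
def fan : Set (PointedCone ℝ (Idx k n → ℝ)) :=
  {σ | ∃ F : Set (Idx k n → ℝ), IsExposed ℝ (polytope k n) F ∧ F ≠ polytope k n ∧
    σ = PointedCone.hull ℝ F}

/-- The sets `E_1, …, E_n`. -/
def E (i : ℕ) : Set (Idx k n → ℤ) :=
  {w | (i = 1 ∧ w = f k n 1 1) ∨
    (2 ≤ i ∧ i ≤ k ∧ ∃ j, j < n - k ∧ w = u k n i j) ∨
    (∃ j, 1 ≤ j ∧ j < n - k ∧ i = k + j ∧ ∃ i', 1 ≤ i' ∧ i' ≤ k ∧ w = v k n i' j) ∨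
    (i = n ∧ w = -f k n k (n - k))}

variable {k n}

lemma vertexSet_finite : (vertexSet k n).Finite := by
  refine Set.Finite.subset (s := {f k n 1 1, -f k n k (n - k)} ∪
    ((fun q : ℕ × ℕ => u k n q.1 q.2) '' (Set.Iic k ×ˢ Set.Iio (n - k)) ∪
     (fun q : ℕ × ℕ => v k n q.1 q.2) '' (Set.Iic k ×ˢ Set.Iio (n - k)))) ?_ ?_
  · refine (Set.toFinite _).union (Set.Finite.union ?_ ?_) <;>
      exact ((Set.finite_Iic k).prod (Set.finite_Iio (n - k))).image _
  · rintro w (rfl | ⟨i, j, -, hi, hj, rfl⟩ | ⟨i, j, -, hi, -, hj, rfl⟩ | rfl)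
    · simp
    · exact Or.inr (Or.inl ⟨(i, j), ⟨hi, hj⟩, rfl⟩)
    · exact Or.inr (Or.inr ⟨(i, j), ⟨hi, hj⟩, rfl⟩)
    · simp

lemma E_finite (i : ℕ) : (E k n i).Finite := by
  refine (vertexSet_finite (k := k) (n := n)).subset ?_
  rintro w (⟨-, rfl⟩ | ⟨h, h', j, hj, rfl⟩ | ⟨j, hj, hj', -, i', hi, hi', rfl⟩ | ⟨-, rfl⟩)
  · exact Or.inl rfl
  · exact Or.inr (Or.inl ⟨i, j, h, h', hj, rfl⟩)
  · exact Or.inr (Or.inr (Or.inl ⟨i', j, hi, hi', hj, hj', rfl⟩))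
  · exact Or.inr (Or.inr (Or.inr rfl))

/-- The linear form `x ↦ ∑ a_p x_p`. -/
def form (a x : Idx k n → ℝ) : ℝ := ∑ p, a p * x p

lemma form_add (a x y : Idx k n → ℝ) : form a (x + y) = form a x + form a y := by
  simp [form, mul_add, Finset.sum_add_distrib]

lemma form_smul (a : Idx k n → ℝ) (t : ℝ) (x : Idx k n → ℝ) : form a (t • x) = t * form a x := by
  simp [form, Finset.mul_sum, mul_left_comm]

lemma form_sub_left (a b x : Idx k n → ℝ) : form (a - b) x = form a x - form b x := by
  simp [form, sub_mul, Finset.sum_sub_distrib]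

/-- The value at `(i, j)` of the extension by zero of `a`. -/
def val (a : Idx k n → ℝ) (i j : ℕ) : ℝ :=
  if h : (i, j) ∈ Finset.Icc 1 k ×ˢ Finset.Icc 1 (n - k) then a ⟨(i, j), h⟩ else 0

lemma form_toReal_f (a : Idx k n → ℝ) (i j : ℕ) : form a (toReal (f k n i j)) = val a i j := by
  unfold form toReal f val
  split_ifs with h
  · rw [Finset.sum_eq_single ⟨(i, j), h⟩]
    · simp
    · intro b _ hb
      have : b.1 ≠ (i, j) := fun h' => hb (Subtype.ext h')
      simp [this]
    · simp
  · refine Finset.sum_eq_zero fun b _ => ?_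
    have : b.1 ≠ (i, j) := fun h' => h (h' ▸ b.2)
    simp [this]

lemma form_toReal_sub (a : Idx k n → ℝ) (w w' : Idx k n → ℤ) :
    form a (toReal (w - w')) = form a (toReal w) - form a (toReal w') := by
  simp [form, toReal, mul_sub, Finset.sum_sub_distrib]

lemma form_toReal_neg (a : Idx k n → ℝ) (w : Idx k n → ℤ) :
    form a (toReal (-w)) = -form a (toReal w) := by
  simp [form, toReal]

/-- A linear form on a vertex is a difference of two of its coefficients (or zero). -/
lemma form_vertex {w : Idx k n → ℤ} (hw : w ∈ vertexSet k n) :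
    ∃ i j i' j' : ℕ, ∀ a : Idx k n → ℝ, form a (toReal w) = val a i j - val a i' j' := by
  have h0 : ∀ a : Idx k n → ℝ, val a 0 0 = 0 := fun a => by simp [val]
  rcases hw with rfl | ⟨i, j, -, -, -, rfl⟩ | ⟨i, j, -, -, -, -, rfl⟩ | rfl
  · exact ⟨1, 1, 0, 0, fun a => by rw [form_toReal_f, h0, sub_zero]⟩
  · exact ⟨i, j + 1, i - 1, j + 1, fun a => by
      rw [u, form_toReal_sub, form_toReal_f, form_toReal_f]⟩
  · exact ⟨i, j + 1, i, j, fun a => by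
      rw [v, form_toReal_sub, form_toReal_f, form_toReal_f]⟩
  · exact ⟨0, 0, k, n - k, fun a => by rw [form_toReal_neg, form_toReal_f, h0, zero_sub]⟩

/-- Every real linear form can be replaced by an integral one with the same signs on vertices. -/
lemma exists_integral (a : Idx k n → ℝ) : ∃ m : Idx k n → ℤ, ∀ w ∈ vertexSet k n,
    (form a (toReal w) = 0 → pairing m (toReal w) = 0) ∧
    (0 < form a (toReal w) → 0 < pairing m (toReal w)) := by
  classical
  let S : Finset ℝ := insert 0 (Finset.univ.image a)
  let r : ℝ → ℤ := fun x => ((S.filter (· < x)).card : ℤ)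
  have hr : ∀ x ∈ S, ∀ y, x < y → r x < r y := by
    intro x hx y hxy
    have : S.filter (· < x) ⊂ S.filter (· < y) := by
      refine Finset.ssubset_iff_subset_ne.2 ⟨fun z hz => ?_, fun h => ?_⟩
      · rw [Finset.mem_filter] at hz ⊢
        exact ⟨hz.1, hz.2.trans hxy⟩
      · have hx' : x ∈ S.filter (· < y) := Finset.mem_filter.2 ⟨hx, hxy⟩
        rw [← h, Finset.mem_filter] at hx'
        exact lt_irrefl _ hx'.2
    exact Int.ofNat_lt.2 (Finset.card_lt_card this)
  let m : Idx k n → ℤ := fun p => r (a p) - r 0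
  have hval : ∀ i j, val (fun p => (m p : ℝ)) i j = ((r (val a i j) - r 0 : ℤ) : ℝ) := by
    intro i j
    unfold val
    split_ifs
    · rfl
    · simp
  have hmem : ∀ i j, val a i j ∈ S := by
    intro i j
    unfold val
    split_ifs with h
    · exact Finset.mem_insert_of_mem (Finset.mem_image_of_mem _ (Finset.mem_univ _))
    · exact Finset.mem_insert_self _ _
  refine ⟨m, fun w hw => ?_⟩
  obtain ⟨i, j, i', j', h⟩ := form_vertex hw
  have hp : pairing m (toReal w) = form (fun p => (m p : ℝ)) (toReal w) := rfl
  rw [hp, h, h, hval, hval]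
  constructor
  · intro h0
    rw [sub_eq_zero.1 h0, sub_self]
  · intro h0
    have := hr _ (hmem i' j') _ (sub_pos.1 h0)
    rw [← Int.cast_sub]
    exact_mod_cast (by omega : (0 : ℤ) < _)

lemma form_le_of_polytope {a : Idx k n → ℝ} {c : ℝ}
    (h : ∀ w ∈ vertexSet k n, form a (toReal w) ≤ c) : ∀ x ∈ polytope k n, form a x ≤ c := by
  refine convexHull_min (t := {x | form a x ≤ c}) ?_ ?_
  · rintro _ ⟨w, hw, rfl⟩
    exact h w hw
  · intro x hx y hy s t hs ht hst
    simp only [Set.mem_ofPred_eq] at *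
    rw [form_add, form_smul, form_smul]
    have e : c = s * c + t * c := by rw [← add_mul, hst, one_mul]
    rw [e]
    exact add_le_add (mul_le_mul_of_nonneg_left hx hs) (mul_le_mul_of_nonneg_left hy ht)

/-- A linear form that is nonpositive on all vertices vanishes. -/
lemma val_eq_zero {a : Idx k n → ℝ} (h : ∀ w ∈ vertexSet k n, form a (toReal w) ≤ 0) :
    a = 0 := by
  have hu : ∀ i j, 2 ≤ i → i ≤ k → j < n - k → val a i (j + 1) ≤ val a (i - 1) (j + 1) := by
    intro i j h1 h2 h3
    have := h (u k n i j) (Or.inr (Or.inl ⟨i, j, h1, h2, h3, rfl⟩))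
    rw [u, form_toReal_sub, form_toReal_f, form_toReal_f] at this
    linarith
  have hv : ∀ i j, 1 ≤ i → i ≤ k → 1 ≤ j → j < n - k → val a i (j + 1) ≤ val a i j := by
    intro i j h1 h2 h3 h4
    have := h (v k n i j) (Or.inr (Or.inr (Or.inl ⟨i, j, h1, h2, h3, h4, rfl⟩)))
    rw [v, form_toReal_sub, form_toReal_f, form_toReal_f] at this
    linarith
  have h1 : val a 1 1 ≤ 0 := by
    have := h _ (Or.inl rfl)
    rwa [form_toReal_f] at this
  have h2 : 0 ≤ val a k (n - k) := by
    have := h _ (Or.inr (Or.inr (Or.inr rfl)))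
    rw [form_toReal_neg, form_toReal_f] at this
    linarith
  have hv' : ∀ i, 1 ≤ i → i ≤ k → ∀ j j', 1 ≤ j → j ≤ j' → j' ≤ n - k →
      val a i j' ≤ val a i j := by
    intro i hi hi' j j' hj hjj'
    induction j', hjj' using Nat.le_induction with
    | base => intro _; exact le_rfl
    | succ q hq ih =>
      intro hq'
      exact (hv i q hi hi' (by omega) (by omega)).trans (ih (by omega))
  have hu' : ∀ j, 1 ≤ j → j ≤ n - k → ∀ i i', 1 ≤ i → i ≤ i' → i' ≤ k →
      val a i' j ≤ val a i j := by
    intro j hj hj' i i' hi hii'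
    induction i', hii' using Nat.le_induction with
    | base => intro _; exact le_rfl
    | succ q hq ih =>
      intro hq'
      have := hu (q + 1) (j - 1) (by omega) (by omega) (by omega)
      rw [Nat.sub_add_cancel hj, Nat.add_sub_cancel] at this
      exact this.trans (ih (by omega))
  funext ⟨⟨i, j⟩, hij⟩
  have hij' := hij
  simp only [Finset.mem_product, Finset.mem_Icc] at hij'
  obtain ⟨⟨hi, hi'⟩, hj, hj'⟩ := hij'
  have e1 := hu' j hj hj' 1 i le_rfl hi hi'
  have e2 := hv' 1 le_rfl (by omega) 1 j le_rfl hj hj'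
  have e3 := hu' j hj hj' i k hi hi' le_rfl
  have e4 := hv' k (by omega) le_rfl j (n - k) hj hj' le_rfl
  have e : val a i j = a ⟨(i, j), hij⟩ := dif_pos hij
  change a ⟨(i, j), hij⟩ = 0
  linarith

/-- Every proper face is cut out by an inequality `form a ≤ 1`. -/
lemma exists_form {F : Set (Idx k n → ℝ)} (hF : IsExposed ℝ (polytope k n) F)
    (hne : F ≠ polytope k n) : ∃ a : Idx k n → ℝ,
      (∀ x ∈ polytope k n, form a x ≤ 1) ∧ ∀ x, x ∈ F ↔ x ∈ polytope k n ∧ form a x = 1 := by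
  rcases F.eq_empty_or_nonempty with rfl | hF0
  · refine ⟨0, fun x _ => ?_, fun x => ?_⟩ <;> simp [form]
  obtain ⟨l, hl⟩ := hF hF0
  let a : Idx k n → ℝ := fun p => l (fun q => if q = p then 1 else 0)
  have hla : ∀ x, l x = form a x := by
    intro x
    have := LinearMap.pi_apply_eq_sum_univ (l : (Idx k n → ℝ) →ₗ[ℝ] ℝ) x
    simp only [ContinuousLinearMap.coe_coe, smul_eq_mul] at this
    rw [this, form]
    refine Finset.sum_congr rfl fun p _ => ?_
    rw [mul_comm]
    congr 2
    funext q
    simp [eq_comm]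
  obtain ⟨x₀, hx₀⟩ := hF0
  have hx₀' := hx₀
  rw [hl] at hx₀'
  obtain ⟨hx₀P, hmax⟩ := hx₀'
  simp only [hla] at hmax
  have hpos : 0 < form a x₀ := by
    by_contra hle
    have ha : a = 0 := val_eq_zero fun w hw =>
      (hmax _ (subset_convexHull ℝ _ ⟨w, hw, rfl⟩)).trans (not_lt.1 hle)
    refine hne ?_
    rw [hl]
    ext x
    simp [hla, ha, form]
  have hform : ∀ x, form ((form a x₀)⁻¹ • a) x = (form a x₀)⁻¹ * form a x := by
    intro x
    simp [form, Finset.mul_sum, mul_assoc]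
  refine ⟨(form a x₀)⁻¹ • a, fun x hx => ?_, fun x => ?_⟩
  · rw [hform, inv_mul_le_iff₀ hpos, mul_one]
    exact hmax x hx
  · rw [hform, inv_mul_eq_iff_eq_mul₀ hpos.ne', mul_one, hl]
    simp only [Set.mem_ofPred_eq, hla]
    refine and_congr_right fun hx => ⟨fun h => le_antisymm (hmax x hx) (h x₀ hx₀P), fun h y hy => ?_⟩
    rw [h]
    exact hmax y hy

lemma form_nonneg_hull {a : Idx k n → ℝ} {s : Set (Idx k n → ℝ)} (h : ∀ x ∈ s, 0 ≤ form a x) :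
    ∀ x ∈ PointedCone.hull ℝ s, 0 ≤ form a x := by
  intro x hx
  induction hx using Submodule.span_induction with
  | mem x hx => exact h x hx
  | zero => simp [form]
  | add x y _ _ hx hy => rw [form_add]; exact add_nonneg hx hy
  | smul t x _ hx =>
    have : form a (t • x) = (t : ℝ) * form a x := form_smul a t x
    rw [this]
    exact mul_nonneg t.2 hx

/-- Membership in the dual monoid of the cone over a face can be tested on vertices. -/
lemma mem_dualMonoid {F : Set (Idx k n → ℝ)} (hF : IsExposed ℝ (polytope k n) F)
    (hne : F ≠ polytope k n) {m : Idx k n → ℤ}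
    (h : ∀ w ∈ vertexSet k n, toReal w ∈ F → 0 ≤ pairing m (toReal w)) :
    m ∈ dualMonoid (PointedCone.hull ℝ F) := by
  obtain ⟨a, ha, haF⟩ := exists_form hF hne
  let b : Idx k n → ℝ := fun p => (m p : ℝ)
  refine form_nonneg_hull (a := b) fun x hx => ?_
  have key : ∀ x ∈ polytope k n, form a x ≤ 1 ∧ (form a x = 1 → 0 ≤ form b x) := by
    refine convexHull_min (t := {x | form a x ≤ 1 ∧ (form a x = 1 → 0 ≤ form b x)}) ?_ ?_
    · rintro _ ⟨w, hw, rfl⟩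
      have hwP : toReal w ∈ polytope k n := subset_convexHull ℝ _ ⟨w, hw, rfl⟩
      exact ⟨ha _ hwP, fun h1 => h w hw ((haF _).2 ⟨hwP, h1⟩)⟩
    · intro x hx y hy s t hs ht hst
      simp only [Set.mem_ofPred_eq] at *
      rw [form_add, form_smul, form_smul, form_add, form_smul, form_smul]
      refine ⟨by nlinarith, fun h1 => ?_⟩
      have h2 : s * (1 - form a x) + t * (1 - form a y) = 0 := by linarith
      have h3 : 0 ≤ s * (1 - form a x) := mul_nonneg hs (by linarith)
      have h4 : 0 ≤ t * (1 - form a y) := mul_nonneg ht (by linarith)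
      have h5 : 0 ≤ s * form b x := by
        rcases mul_eq_zero.1 (by linarith : s * (1 - form a x) = 0) with h | h
        · rw [h, zero_mul]
        · exact mul_nonneg hs (hx.2 (by linarith))
      have h6 : 0 ≤ t * form b y := by
        rcases mul_eq_zero.1 (by linarith : t * (1 - form a y) = 0) with h | h
        · rw [h, zero_mul]
        · exact mul_nonneg ht (hy.2 (by linarith))
      linarith
  obtain ⟨hxP, hx1⟩ := (haF x).1 hx
  exact (key x hxP).2 hx1

lemma face_subset {F G : Set (Idx k n → ℝ)} (hF : IsExposed ℝ (polytope k n) F)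
    (hFne : F ≠ polytope k n) (hG : IsExposed ℝ (polytope k n) G) (hGne : G ≠ polytope k n)
    (h : PointedCone.hull ℝ F ≤ PointedCone.hull ℝ G) : F ⊆ G := by
  obtain ⟨a, ha, haF⟩ := exists_form hF hFne
  obtain ⟨b, hb, hbG⟩ := exists_form hG hGne
  intro x hx
  obtain ⟨hxP, hx1⟩ := (haF x).1 hx
  have := form_nonneg_hull (a := b - a) (s := G) (fun y hy => by
    obtain ⟨hyP, hy1⟩ := (hbG y).1 hy
    rw [form_sub_left, hy1]
    linarith [ha y hyP]) x (h (PointedCone.subset_hull hx))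
  rw [form_sub_left, hx1] at this
  exact (hbG x).2 ⟨hxP, le_antisymm (hb x hxP) (by linarith)⟩

lemma exists_pairing {F G : Set (Idx k n → ℝ)} (hF : IsExposed ℝ (polytope k n) F)
    (hFne : F ≠ polytope k n) (hG : IsExposed ℝ (polytope k n) G) (hGne : G ≠ polytope k n)
    (h : F ⊆ G) : ∃ m : Idx k n → ℤ,
      (∀ w ∈ vertexSet k n, toReal w ∈ F → pairing m (toReal w) = 0) ∧
      (∀ w ∈ vertexSet k n, toReal w ∈ G → toReal w ∉ F → 0 < pairing m (toReal w)) := by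
  obtain ⟨a, ha, haF⟩ := exists_form hF hFne
  obtain ⟨b, hb, hbG⟩ := exists_form hG hGne
  obtain ⟨m, hm⟩ := exists_integral (b - a)
  refine ⟨m, fun w hw hwF => (hm w hw).1 ?_, fun w hw hwG hwF => (hm w hw).2 ?_⟩
  · rw [form_sub_left, ((haF _).1 hwF).2, ((hbG _).1 (h hwF)).2, sub_self]
  · rw [form_sub_left, ((hbG _).1 hwG).2, sub_pos]
    exact lt_of_le_of_ne (ha _ ((hbG _).1 hwG).1)
      fun h1 => hwF ((haF _).2 ⟨((hbG _).1 hwG).1, h1⟩)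

lemma pairing_toReal (m w : Idx k n → ℤ) :
    pairing m (toReal w) = ((∑ p, m p * w p : ℤ) : ℝ) := by
  simp [pairing, toReal]

lemma cutsOut {F G : Set (Idx k n → ℝ)} (hF : IsExposed ℝ (polytope k n) F)
    (hFne : F ≠ polytope k n) (hG : IsExposed ℝ (polytope k n) G) (hGne : G ≠ polytope k n)
    (h : F ⊆ G) {m : Idx k n → ℤ}
    (h0 : ∀ w ∈ vertexSet k n, toReal w ∈ F → pairing m (toReal w) = 0)
    (h1 : ∀ w ∈ vertexSet k n, toReal w ∈ G → toReal w ∉ F → 0 < pairing m (toReal w)) :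
    CutsOut m (PointedCone.hull ℝ F) (PointedCone.hull ℝ G) where
  le := Submodule.span_mono h
  mem := mem_dualMonoid hG hGne fun w hw hwG => by
    by_cases hwF : toReal w ∈ F
    · exact (h0 w hw hwF).ge
    · exact (h1 w hw hwG hwF).le
  neg_mem := mem_dualMonoid hF hFne fun w hw hwF => by
    rw [pairing_neg, h0 w hw hwF, neg_zero]
  exists_add := by
    intro b hb
    have hfin := vertexSet_finite (k := k) (n := n)
    let N : ℕ := ∑ w ∈ hfin.toFinset, (∑ p, b p * w p).natAbs
    refine ⟨N, mem_dualMonoid hG hGne fun w hw hwG => ?_⟩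
    rw [pairing_add, pairing_nsmul]
    by_cases hwF : toReal w ∈ F
    · rw [h0 w hw hwF, mul_zero, add_zero]
      exact hb _ (PointedCone.subset_hull hwF)
    · have hpos := h1 w hw hwG hwF
      rw [pairing_toReal] at hpos ⊢
      rw [pairing_toReal]
      have hN : (∑ p, b p * w p).natAbs ≤ N :=
        Finset.single_le_sum (f := fun w => (∑ p, b p * w p).natAbs) (fun _ _ => Nat.zero_le _)
          (hfin.mem_toFinset.2 hw)
      have hpos' : 1 ≤ ∑ p, m p * w p := by exact_mod_cast hpos
      have : 0 ≤ (∑ p, b p * w p) + (N : ℤ) * ∑ p, m p * w p := by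
        have : (N : ℤ) ≤ N * ∑ p, m p * w p := by nlinarith
        omega
      exact_mod_cast this

variable (k n)

lemma fan_isGluable : IsGluable (fan k n) := by
  rintro _ ⟨F, hF, hFne, rfl⟩ _ ⟨F', hF', hFne', rfl⟩ _ ⟨G, hG, hGne, rfl⟩ h h'
  have hFG := face_subset hF hFne hG hGne h
  have hFG' := face_subset hF' hFne' hG hGne h'
  obtain ⟨m, h0, h1⟩ := exists_pairing hF hFne hG hGne hFG
  obtain ⟨m', h0', h1'⟩ := exists_pairing hF' hFne' hG hGne hFG'
  have hI := hF.inter hF'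
  have hIne : F ∩ F' ≠ polytope k n := fun he =>
    hFne (Set.Subset.antisymm hF.subset (he ▸ Set.inter_subset_left))
  refine ⟨m, m', cutsOut hF hFne hG hGne hFG h0 h1, cutsOut hF' hFne' hG hGne hFG' h0' h1',
    PointedCone.hull ℝ (F ∩ F'), ⟨_, hI, hIne, rfl⟩, Submodule.span_mono Set.inter_subset_left,
    Submodule.span_mono Set.inter_subset_right,
    cutsOut hI hIne hG hGne (Set.inter_subset_left.trans hFG) ?_ ?_⟩
  · rintro w hw ⟨hwF, hwF'⟩
    rw [pairing_add, h0 w hw hwF, h0' w hw hwF', add_zero]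
  · intro w hw hwG hwI
    rw [pairing_add]
    by_cases hwF : toReal w ∈ F
    · have hwF' : toReal w ∉ F' := fun h => hwI ⟨hwF, h⟩
      rw [h0 w hw hwF, zero_add]
      exact h1' w hw hwG hwF'
    · have := h1 w hw hwG hwF
      by_cases hwF' : toReal w ∈ F'
      · rw [h0' w hw hwF', add_zero]
        exact this
      · exact add_pos this (h1' w hw hwG hwF')

/-- The toric variety `P(k,n)` of the fan `Σ(k,n)`. -/
def P : Scheme.{0} := toricVariety (fan k n) (fan_isGluable k n)

/-- The divisor `D(E_i)` on `P(k,n)`: its components are the torus invariant prime divisors that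
correspond to the elements of `E_i`, each with multiplicity one. -/
def D (i : ℕ) : AlgebraicCycle (P k n) ℤ :=
  reducedDivisor (fan k n) (fan_isGluable k n) (E k n i) (E_finite i)

end GrassmannianToric

end

/-!
A vertex `w` of the polytope is an edge of the ladder diagram with nodes `(i, j)`, and a lattice
point `m` of `M` is a potential on the nodes: the pairing of `m` with `w` is the difference of the
values of `m` at the ends of the edge `w`. The sets `E_1, …, E_n` are disjoint cuts of the diagram,
and the indicator `pot (cut k i)` of the nodes behind a cut pairs with `w` to the indicator of `E_i`
minus that of `E_n` (`pairing_cut_eq`). As the order of a character `χ^m` along the invariant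
divisor of `w` is the pairing of `m` with `w` (`ord_chi_rayPoint`), and as characters have no zeros
on the torus, the divisors `D(E_i)` are linearly equivalent.

For a proper face, the linear form that is one on the face differs from `pot rank` by a real
potential that pairs, up to the factor `n`, to one with the vertices of the face in `E_n` and to
zero with its other vertices; a staircase function turns it into an integral potential
(`exists_support`). With one step, its character is a local equation of `D(E_i)` on the chart of
the face. With sufficiently many steps, it is a support function of a multiple of `D(E_i)` that is
strictly smaller on all edges outside the face, so that the chart of the face is the complement of
the support of an effective divisor in a multiple of the class of `D(E_i)`. This is ampleness.

A point of a chart lies in the smaller chart of a subface unless it lies on an invariant divisor of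
one of the vertices that are left out (`Face.exists_comap_eq`). In particular the points of
codimension one outside the torus are the generic points `rayPoint w` of the invariant divisors, and
they have different vertices `w`, since every vertex spans a ray of the fan (`exists_vertexFace`).

The Picard group is computed without cohomology and without the normality of the charts. If
`t D(E_i)` is the divisor of `f`, then `f` has no zeros and poles on the torus; since the ring of
Laurent polynomials is factorial, `f` is a monomial, and the pairings of its exponent with the
vertices all have the sign of `t` or vanish. As zero is an interior point of the polytope, the
exponent is zero, and so is `t` (`eq_zero_of_zsmul_D_mem`). Conversely, all vertices outside `E_n`
lie on one proper face, whose chart has a torus fixed point (`exists_fixedPoint`). A Cartier divisor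
is principal near this point. After subtracting the principal divisor, the prime divisors remaining
on the torus avoid the fixed point, and each of them has an equation on the chart that does not
vanish at the fixed point: a factor of a regular function with nonzero constant term becomes, after
multiplication by a character, regular with nonzero constant term (`exists_toTorus_eq_mul_chi`). So
the divisor is linearly equivalent to one that is supported on the invariant divisor of the only
element of `E_n` (`exists_sub_zsmul_D_mem`), a multiple of `D(E_n)`.
-/

noncomputable section

/-! ### Orders of vanishing in an affine chart -/

namespace DivisorTheory

open AlgebraicGeometry.Scheme Order

section Chart

variable {X : Scheme.{0}} {R : CommRingCat.{0}} (j : Spec R ⟶ X) [IsOpenImmersion j]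

/-- The ring of an affine chart, as the ring of sections over the image of the chart. -/
def chartSection : R ⟶ Γ(X, j ''ᵁ ⊤) := (ΓSpecIso R).inv ≫ (j.appIso ⊤).inv

instance : IsIso (chartSection j) := by unfold chartSection; infer_instance

lemma chartSection_appLE :
    chartSection j ≫ j.appLE (j ''ᵁ ⊤) ⊤ (by simp) = (ΓSpecIso R).inv := by
  simp [chartSection]

lemma mem_image_top (p : Spec R) : j p ∈ j ''ᵁ ⊤ := ⟨p, trivial, rfl⟩

/-- The map from the ring of an affine chart to the stalk at a point of the chart. -/
def chartStalk (p : Spec R) : R ⟶ X.presheaf.stalk (j p) :=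
  chartSection j ≫ X.presheaf.germ (j ''ᵁ ⊤) (j p) (mem_image_top j p)

lemma chartStalk_stalkMap (p : Spec R) :
    chartStalk j p ≫ j.stalkMap p = (ΓSpecIso R).inv ≫ (Spec R).presheaf.germ ⊤ p trivial := by
  rw [chartStalk, Category.assoc, Hom.germ_stalkMap, chartSection]
  simp only [Category.assoc, Hom.appIso_inv_app_assoc]
  exact congrArg ((ΓSpecIso R).inv ≫ ·) (TopCat.Presheaf.germ_res' _ _ _ _)

lemma isLocalization_chartStalk (p : Spec R) [hp : p.asIdeal.IsPrime] :
    @IsLocalization.AtPrime _ _ (X.presheaf.stalk (j p)) _ (chartStalk j p).hom.toAlgebra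
      p.asIdeal _ := by
  let _ := (chartStalk j p).hom.toAlgebra
  let k : Algebra ↑R ↑((Spec R).presheaf.stalk p) := StructureSheaf.stalkAlgebra (↑R) p
  have : IsLocalization.AtPrime (↑((Spec R).presheaf.stalk p)) p.asIdeal :=
    StructureSheaf.IsLocalization.to_stalk R p
  let e : X.presheaf.stalk (j p) ≃+* (Spec R).presheaf.stalk p :=
    (asIso (j.stalkMap p)).commRingCatIsoToRingEquiv
  let e' : (Spec R).presheaf.stalk p ≃ₐ[R] X.presheaf.stalk (j p) :=
    (AlgEquiv.ofRingEquiv (f := e) fun r => congr($(chartStalk_stalkMap j p) r)).symm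
  exact IsLocalization.isLocalization_of_algEquiv _ e'

lemma coheight_chart (p : Spec R) : coheight (j p) = p.asIdeal.height := by
  rw [idealHeight_eq_coheight]
  exact coheight_eq_of_isOpenImmersion j

lemma coheight_eq_one_of_span [IsDomain R] [IsNoetherianRing R] (p : Spec R) {t : R} (ht : t ≠ 0)
    (hp : p.asIdeal = Ideal.span {t}) : coheight (j p) = 1 := by
  rw [coheight_chart, hp]
  refine Ideal.height_span_singleton_eq_one_of_mem_nonZeroDivisors
    (mem_nonZeroDivisors_of_ne_zero ht) fun hu => ?_
  exact p.isPrime.ne_top (hp.trans (Ideal.span_singleton_eq_top.2 hu))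

end Chart

section RatFun

variable {X : Scheme.{0}} [IsIntegral X] {R : CommRingCat.{0}} [IsDomain R]
  (j : Spec R ⟶ X) [IsOpenImmersion j]

instance : Nonempty (j ''ᵁ ⊤ : X.Opens) := ⟨⟨_, mem_image_top j (Classical.arbitrary (Spec R))⟩⟩

/-- The functions on an affine chart, as rational functions. -/
def ratFun : R →+* X.functionField := (chartSection j ≫ X.germToFunctionField (j ''ᵁ ⊤)).hom

lemma algebraMap_chartStalk (p : Spec R) (r : R) :
    algebraMap (X.presheaf.stalk (j p)) X.functionField (chartStalk j p r) = ratFun j r :=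
  algebraMap_germ_eq_germToFunctionField _ (mem_image_top j p) (chartSection j r)

lemma ratFun_injective : Function.Injective (ratFun j) := by
  refine (X.germToFunctionField_injective (j ''ᵁ ⊤)).comp ?_
  exact (ConcreteCategory.bijective_of_isIso (chartSection j)).1

lemma ratFun_ne_zero {r : R} (hr : r ≠ 0) : ratFun j r ≠ 0 :=
  (map_ne_zero_iff _ (ratFun_injective j)).2 hr

lemma exists_ratFun_div (f : X.functionField) :
    ∃ p q : R, q ≠ 0 ∧ f = ratFun j p / ratFun j q := by
  have hU : IsAffineOpen (j ''ᵁ ⊤) := (isAffineOpen_top (Spec R)).image_of_isOpenImmersion j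
  have := functionField_isFractionRing_of_isAffineOpen X (j ''ᵁ ⊤) hU
  obtain ⟨a, b, hb, rfl⟩ := IsFractionRing.div_surjective (A := Γ(X, j ''ᵁ ⊤)) f
  have hs := (ConcreteCategory.bijective_of_isIso (chartSection j)).2
  obtain ⟨p, rfl⟩ := hs a
  obtain ⟨q, rfl⟩ := hs b
  refine ⟨p, q, ?_, rfl⟩
  rintro rfl
  rw [map_zero] at hb
  exact zero_notMem_nonZeroDivisors hb

lemma ratFun_comp {S : CommRingCat.{0}} [IsDomain S] (i : Spec S ⟶ X) [IsOpenImmersion i]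
    (a : R ⟶ S) (h : Spec.map a ≫ j = i) (r : R) : ratFun i (a r) = ratFun j r := by
  subst h
  have : IsOpenImmersion (Spec.map a) := IsOpenImmersion.of_comp _ j
  let i := Spec.map a ≫ j
  have hle : i ''ᵁ ⊤ ≤ j ''ᵁ ⊤ := by
    rw [Hom.comp_image]
    exact Hom.image_mono _ le_top
  have hi : ⊤ ≤ i ⁻¹ᵁ i ''ᵁ ⊤ := (Hom.preimage_image_eq i ⊤).ge
  have key : a ≫ chartSection i = chartSection j ≫ X.presheaf.map (homOfLE hle).op := by
    have : IsIso (i.appLE (i ''ᵁ ⊤) ⊤ hi) := by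
      rw [← Hom.appIso_hom']
      infer_instance
    rw [← cancel_mono (i.appLE (i ''ᵁ ⊤) ⊤ hi), Category.assoc, chartSection_appLE,
      Category.assoc, Hom.map_appLE, ← Hom.appLE_comp_appLE _ _ _ ⊤ _ (by simp) (by simp),
      ← Category.assoc, chartSection_appLE, ΓSpecIso_inv_naturality, Hom.appTop, Hom.app_eq_appLE]
    rfl
  have h2 : a ≫ chartSection i ≫ X.germToFunctionField (i ''ᵁ ⊤) =
      chartSection j ≫ X.germToFunctionField (j ''ᵁ ⊤) := by
    rw [← Category.assoc, key, Category.assoc]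
    congr 1
    exact TopCat.Presheaf.germ_res _ _ _ _
  exact congr($h2 r)

variable [IsLocallyNoetherian X]

lemma ord_one (y : X) : ord (1 : X.functionField) y = 0 := by
  have h : ord (1 * 1 : X.functionField) y = _ := ord_mul one_ne_zero one_ne_zero
  rw [mul_one] at h
  omega

lemma ord_inv {f : X.functionField} (hf : f ≠ 0) (y : X) : ord f⁻¹ y = -ord f y := by
  have h := ord_mul (x := y) hf (inv_ne_zero hf)
  rw [mul_inv_cancel₀ hf, ord_one] at h
  omega

lemma ord_div {f g : X.functionField} (hf : f ≠ 0) (hg : g ≠ 0) (y : X) :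
    ord (f / g) y = ord f y - ord g y := by
  rw [div_eq_mul_inv, ord_mul hf (inv_ne_zero hg), ord_inv hg, sub_eq_add_neg]

lemma ord_zpow {f : X.functionField} (hf : f ≠ 0) (y : X) (m : ℤ) :
    ord (f ^ m) y = m * ord f y := by
  induction m using Int.induction_on with
  | zero => simp [ord_one]
  | succ i ih => rw [zpow_add_one₀ hf, ord_mul (zpow_ne_zero _ hf) hf, ih]; ring
  | pred i ih => rw [zpow_sub_one₀ hf, ord_mul (zpow_ne_zero _ hf) (inv_ne_zero hf), ih,
      ord_inv hf]; ring

lemma ord_prod {ι : Type*} (s : Finset ι) (f : ι → X.functionField) (hf : ∀ a ∈ s, f a ≠ 0)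
    (y : X) : ord (∏ a ∈ s, f a) y = ∑ a ∈ s, ord (f a) y := by
  classical
  induction s using Finset.induction_on with
  | empty => simp [ord_one]
  | insert a s ha ih =>
    have h := fun b hb => hf b (Finset.mem_insert_of_mem hb)
    rw [Finset.prod_insert ha, Finset.sum_insert ha,
      ord_mul (hf a (Finset.mem_insert_self a s)) (Finset.prod_ne_zero_iff.2 h), ih h]

lemma ord_ratFun_eq_zero (p : Spec R) {r : R} (hr : r ∉ p.asIdeal) :
    ord (ratFun j r) (j p) = 0 := by
  by_cases hc : coheight (j p) = 1
  · have hr0 : r ≠ 0 := by rintro rfl; exact hr p.asIdeal.zero_mem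
    rw [ord_eq_iff hc (ratFun_ne_zero j hr0), ← algebraMap_chartStalk j p]
    have hp : p.asIdeal.IsPrime := p.isPrime
    let _ := (chartStalk j p).hom.toAlgebra
    have := isLocalization_chartStalk j p
    have hu : IsUnit (chartStalk j p r) :=
      IsLocalization.map_units (X.presheaf.stalk (j p)) (⟨r, hr⟩ : p.asIdeal.primeCompl)
    have : Ring.KrullDimLE 1 (X.presheaf.stalk (j p)) := krullDimLE_of_coheight_le hc.le
    exact Ring.ordFrac_of_isUnit hu
  · exact ord_eq_zero_of_coheight_neq_one hc _

lemma ord_ratFun_eq_one [IsNoetherianRing R] (p : Spec R) {t : R} (ht : t ≠ 0)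
    (hp : p.asIdeal = Ideal.span {t}) : ord (ratFun j t) (j p) = 1 := by
  have hc := coheight_eq_one_of_span j p ht hp
  rw [ord_eq_iff hc (ratFun_ne_zero j ht), ← algebraMap_chartStalk j p]
  have hpp : p.asIdeal.IsPrime := p.isPrime
  let _ := (chartStalk j p).hom.toAlgebra
  have hloc := isLocalization_chartStalk j p
  have : Ring.KrullDimLE 1 (X.presheaf.stalk (j p)) := krullDimLE_of_coheight_le hc.le
  have ht' : chartStalk j p t ≠ 0 := fun h => ratFun_ne_zero j ht (by
    rw [← algebraMap_chartStalk j p, h, map_zero])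
  have hmax : Ideal.span {chartStalk j p t} =
      IsLocalRing.maximalIdeal (X.presheaf.stalk (j p)) := by
    have := IsLocalization.AtPrime.map_eq_maximalIdeal p.asIdeal (X.presheaf.stalk (j p))
    rw [← this, hp, Ideal.map_span, Set.image_singleton]
    rfl
  have h1 : Ring.ord (X.presheaf.stalk (j p)) (chartStalk j p t) = (1 : ℕ) := by
    rw [Ring.ord, hmax, Nat.cast_one, Module.length_eq_one_iff]
    exact isSimpleModule_iff_isCoatom.2 (IsLocalRing.maximalIdeal.isMaximal _).out
  change Ring.ordFrac (X.presheaf.stalk (j p)) _ = _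
  rw [Ring.ordFrac_eq_ord _ ht',
    Ring.ordMonoidWithZeroHom_eq_coe _ (mem_nonZeroDivisors_of_ne_zero ht') h1]
  rfl

end RatFun

end DivisorTheory

/-! ### Semigroup algebras and Laurent polynomials -/

namespace Toric

section Weights

variable {R M : Type*} [Semiring R] [AddMonoid M]

lemma exists_add_of_mem_support_mul {p q : AddMonoidAlgebra R M} {c : M}
    (h : (p * q).coeff c ≠ 0) : ∃ a b, p.coeff a ≠ 0 ∧ q.coeff b ≠ 0 ∧ a + b = c := by
  classical
  have := AddMonoidAlgebra.support_coeff_mul_subset p q (Finsupp.mem_support_iff.2 h)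
  obtain ⟨a, ha, b, hb, hab⟩ := Finset.mem_add.1 this
  exact ⟨a, b, Finsupp.mem_support_iff.1 ha, Finsupp.mem_support_iff.1 hb, hab⟩

/-- Additivity of the lowest weight of an element of a monoid algebra: the parts of lowest weight
of two factors have a nonzero product. -/
lemma exists_weight_le [NoZeroDivisors (AddMonoidAlgebra R M)] (l : M →+ ℝ)
    {p q : AddMonoidAlgebra R M} {a b : M} (ha : p.coeff a ≠ 0) (hb : q.coeff b ≠ 0) :
    ∃ m, (p * q).coeff m ≠ 0 ∧ l m ≤ l a + l b := by
  classical
  obtain ⟨a₀, ha₀, hamin⟩ := p.coeff.support.exists_min_image l ⟨a, Finsupp.mem_support_iff.2 ha⟩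
  obtain ⟨b₀, hb₀, hbmin⟩ := q.coeff.support.exists_min_image l ⟨b, Finsupp.mem_support_iff.2 hb⟩
  let p₁ : AddMonoidAlgebra R M := .ofCoeff (p.coeff.filter (fun m => l m = l a₀))
  let p₂ : AddMonoidAlgebra R M := .ofCoeff (p.coeff.filter (fun m => ¬ l m = l a₀))
  let q₁ : AddMonoidAlgebra R M := .ofCoeff (q.coeff.filter (fun m => l m = l b₀))
  let q₂ : AddMonoidAlgebra R M := .ofCoeff (q.coeff.filter (fun m => ¬ l m = l b₀))
  have hp : p = p₁ + p₂ := AddMonoidAlgebra.ext (Finsupp.filter_add_filter_not _ _).symm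
  have hq : q = q₁ + q₂ := AddMonoidAlgebra.ext (Finsupp.filter_add_filter_not _ _).symm
  have hp₁ : p₁ ≠ 0 := fun h0 => by
    have : p₁.coeff a₀ = p.coeff a₀ := Finsupp.filter_apply_pos _ _ rfl
    rw [h0] at this
    exact Finsupp.mem_support_iff.1 ha₀ this.symm
  have hq₁ : q₁ ≠ 0 := fun h0 => by
    have : q₁.coeff b₀ = q.coeff b₀ := Finsupp.filter_apply_pos _ _ rfl
    rw [h0] at this
    exact Finsupp.mem_support_iff.1 hb₀ this.symm
  have w₁ : ∀ m, p₁.coeff m ≠ 0 → l m = l a₀ := fun m hm => by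
    by_contra hne
    exact hm (Finsupp.filter_apply_neg _ _ hne)
  have w₂ : ∀ m, p₂.coeff m ≠ 0 → l a₀ < l m := fun m hm => by
    have hne : ¬ l m = l a₀ := fun he => hm (Finsupp.filter_apply_neg _ _ (not_not.2 he))
    have : p₂.coeff m = p.coeff m := Finsupp.filter_apply_pos _ _ hne
    rw [this] at hm
    exact lt_of_le_of_ne (hamin m (Finsupp.mem_support_iff.2 hm)) (Ne.symm hne)
  have v₁ : ∀ m, q₁.coeff m ≠ 0 → l m = l b₀ := fun m hm => by
    by_contra hne
    exact hm (Finsupp.filter_apply_neg _ _ hne)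
  have v₂ : ∀ m, q₂.coeff m ≠ 0 → l b₀ < l m := fun m hm => by
    have hne : ¬ l m = l b₀ := fun he => hm (Finsupp.filter_apply_neg _ _ (not_not.2 he))
    have : q₂.coeff m = q.coeff m := Finsupp.filter_apply_pos _ _ hne
    rw [this] at hm
    exact lt_of_le_of_ne (hbmin m (Finsupp.mem_support_iff.2 hm)) (Ne.symm hne)
  obtain ⟨m, hm⟩ : ∃ m, (p₁ * q₁).coeff m ≠ 0 := by
    by_contra! h0
    exact mul_ne_zero hp₁ hq₁ (AddMonoidAlgebra.ext (Finsupp.ext h0))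
  have hlm : l m = l a₀ + l b₀ := by
    obtain ⟨a', b', ha', hb', rfl⟩ := exists_add_of_mem_support_mul hm
    rw [map_add, w₁ a' ha', v₁ b' hb']
  have z₁ : (p₁ * q₂).coeff m = 0 := by
    by_contra h0
    obtain ⟨a', b', ha', hb', rfl⟩ := exists_add_of_mem_support_mul h0
    rw [map_add] at hlm
    linarith [w₁ a' ha', v₂ b' hb']
  have z₂ : (p₂ * q).coeff m = 0 := by
    by_contra h0
    obtain ⟨a', b', ha', hb', rfl⟩ := exists_add_of_mem_support_mul h0
    rw [map_add] at hlm
    linarith [w₂ a' ha', hbmin b' (Finsupp.mem_support_iff.2 hb')]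
  have hpq : (p * q).coeff m ≠ 0 := by
    have : p * q = p₁ * q₁ + p₁ * q₂ + p₂ * q := by
      rw [← mul_add, ← hq, ← add_mul, ← hp]
    rw [this, AddMonoidAlgebra.coeff_add, AddMonoidAlgebra.coeff_add, Finsupp.add_apply,
      Finsupp.add_apply, z₁, z₂, add_zero, add_zero]
    exact hm
  refine ⟨m, hpq, ?_⟩
  linarith [hamin a (Finsupp.mem_support_iff.2 ha), hbmin b (Finsupp.mem_support_iff.2 hb)]

end Weights

variable {ι : Type}

/-- The ring `ℂ[M]` of Laurent polynomials, the coordinate ring of the torus. -/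
abbrev TorusRing (ι : Type) : Type := AddMonoidAlgebra ℂ (ι → ℤ)

/-- The character `χ^m`, as a Laurent polynomial. -/
def chi (m : ι → ℤ) : TorusRing ι := AddMonoidAlgebra.single m 1

lemma chi_mul (m m' : ι → ℤ) : chi m * chi m' = chi (m + m') := by
  simp [chi, AddMonoidAlgebra.single_mul_single]

lemma chi_zero : chi (0 : ι → ℤ) = 1 := rfl

lemma chi_mul_neg (m : ι → ℤ) : chi m * chi (-m) = 1 := by
  rw [chi_mul, add_neg_cancel, chi_zero]

lemma isUnit_chi (m : ι → ℤ) : IsUnit (chi m) := IsUnit.of_mul_eq_one _ (chi_mul_neg m)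

lemma coeff_mul_chi (p : TorusRing ι) (m a : ι → ℤ) : (p * chi m).coeff a = p.coeff (a - m) := by
  rw [chi, AddMonoidAlgebra.coeff_mul_single_apply, mul_one, sub_eq_add_neg]

/-- The units of the ring of Laurent polynomials are the monomials. -/
lemma exists_eq_single_of_isUnit {p : TorusRing ι} (hp : IsUnit p) :
    ∃ (m : ι → ℤ) (c : ℂ), c ≠ 0 ∧ p = AddMonoidAlgebra.single m c := by
  obtain ⟨q, hq⟩ := hp.exists_right_inv
  obtain ⟨b, hb⟩ : ∃ b, q.coeff b ≠ 0 := by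
    by_contra! h0
    have : q = 0 := AddMonoidAlgebra.ext (Finsupp.ext h0)
    rw [this, mul_zero] at hq
    exact zero_ne_one hq
  have h1 : ∀ m, (p * q).coeff m ≠ 0 → m = 0 := fun m hm => by
    by_contra hne
    rw [hq] at hm
    exact hm (Finsupp.single_eq_of_ne hne)
  have key : ∀ a, p.coeff a ≠ 0 → a = -b := fun a ha => by
    funext i
    let l : (ι → ℤ) →+ ℝ := (Int.castAddHom ℝ).comp (Pi.evalAddMonoidHom _ i)
    obtain ⟨m, hm, e1⟩ := exists_weight_le l ha hb
    obtain ⟨m', hm', e2⟩ := exists_weight_le (-l) ha hb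
    rw [h1 m hm, map_zero] at e1
    rw [h1 m' hm', map_zero] at e2
    have hl : l a + l b = ((a i + b i : ℤ) : ℝ) := by simp [l]
    rw [AddMonoidHom.neg_apply, AddMonoidHom.neg_apply, ← neg_add, hl] at e2
    rw [hl] at e1
    have e3 : 0 ≤ a i + b i := by exact_mod_cast e1
    have e4 : a i + b i ≤ 0 := by exact_mod_cast neg_nonneg.1 e2
    simp only [Pi.neg_apply]
    omega
  have hp : p = AddMonoidAlgebra.single (-b) (p.coeff (-b)) := by
    refine AddMonoidAlgebra.ext (Finsupp.ext fun a => ?_)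
    by_cases ha : a = -b
    · rw [ha]; simp
    · rw [AddMonoidAlgebra.coeff_single, Finsupp.single_eq_of_ne ha]
      by_contra h0
      exact ha (key a h0)
  refine ⟨-b, p.coeff (-b), fun h0 => ?_, hp⟩
  rw [hp, h0, AddMonoidAlgebra.single_zero, zero_mul] at hq
  exact zero_ne_one hq

section UFD

/-- The inclusion of the ordinary exponents into the Laurent exponents. -/
def natExponent (ι : Type) : (ι →₀ ℕ) →+ (ι → ℤ) where
  toFun m i := m i
  map_zero' := by ext; simp
  map_add' m m' := by ext; simp

lemma natExponent_injective : Function.Injective (natExponent ι) := fun _ _ h =>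
  Finsupp.ext fun i => Int.ofNat_injective (congrFun h i)

variable [Fintype ι]

/-- Laurent polynomials arise from polynomials by inverting the product of the variables. -/
lemma isLocalization_torusRing :
    @IsLocalization.Away (AddMonoidAlgebra ℂ (ι →₀ ℕ)) _
      (AddMonoidAlgebra.single (Finsupp.equivFunOnFinite.symm fun _ => 1) 1) (TorusRing ι) _
      (AddMonoidAlgebra.mapDomainRingHom ℂ (natExponent ι)).toAlgebra := by
  let φ := AddMonoidAlgebra.mapDomainRingHom ℂ (natExponent ι)
  let _ := φ.toAlgebra
  let e : ι →₀ ℕ := Finsupp.equivFunOnFinite.symm fun _ => 1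
  let x : AddMonoidAlgebra ℂ (ι →₀ ℕ) := AddMonoidAlgebra.single e 1
  have hφ : ∀ (m : ι →₀ ℕ) (c : ℂ), φ (AddMonoidAlgebra.single m c) =
      AddMonoidAlgebra.single (natExponent ι m) c := fun m c => by simp [φ]
  have hx : ∀ N : ℕ, φ (x ^ N) = chi fun _ => (N : ℤ) := fun N => by
    simp only [x, AddMonoidAlgebra.single_pow, one_pow, hφ]
    congr 1
    ext i
    simp [natExponent, e]
  refine (isLocalization_iff _ _).2 ⟨?_, ?_, ?_⟩
  · rintro ⟨_, N, rfl⟩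
    change IsUnit (φ (x ^ N))
    rw [hx]
    exact isUnit_chi _
  · intro z
    suffices H : ∃ N : ℕ, ∃ r, z * φ (x ^ N) = φ r by
      obtain ⟨N, r, hr⟩ := H
      exact ⟨⟨r, ⟨_, N, rfl⟩⟩, hr⟩
    induction z using AddMonoidAlgebra.induction_linear with
    | zero => exact ⟨0, 0, by simp⟩
    | add f g hf hg =>
      obtain ⟨N, r, hr⟩ := hf
      obtain ⟨N', r', hr'⟩ := hg
      refine ⟨N + N', r * x ^ N' + r' * x ^ N, ?_⟩
      rw [map_add, map_mul, map_mul, ← hr, ← hr', pow_add, map_mul]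
      ring
    | single a c =>
      refine ⟨∑ i, (a i).natAbs, AddMonoidAlgebra.single (Finsupp.equivFunOnFinite.symm
        fun i => (a i + ∑ i, (a i).natAbs).toNat) c, ?_⟩
      rw [hx, hφ, chi, AddMonoidAlgebra.single_mul_single, mul_one]
      congr 1
      ext i
      have : (a i).natAbs ≤ ∑ i, (a i).natAbs :=
        Finset.single_le_sum (f := fun i => (a i).natAbs) (fun _ _ => Nat.zero_le _)
          (Finset.mem_univ i)
      simp only [natExponent, Pi.add_apply, AddMonoidHom.coe_mk, ZeroHom.coe_mk,
        Finsupp.equivFunOnFinite_symm_apply_apply]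
      omega
  · intro y z hyz
    exact ⟨1, by rw [AddMonoidAlgebra.mapDomain_injective natExponent_injective hyz]⟩

instance : UniqueFactorizationMonoid (TorusRing ι) := by
  let _ := (AddMonoidAlgebra.mapDomainRingHom ℂ (natExponent ι)).toAlgebra
  have := isLocalization_torusRing (ι := ι)
  have : UniqueFactorizationMonoid (AddMonoidAlgebra ℂ (ι →₀ ℕ)) :=
    inferInstanceAs (UniqueFactorizationMonoid (MvPolynomial ι ℂ))
  exact UniqueFactorizationMonoid.of_isLocalization (Submonoid.powers
    (AddMonoidAlgebra.single (Finsupp.equivFunOnFinite.symm fun _ => 1) 1 :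
      AddMonoidAlgebra ℂ (ι →₀ ℕ))) (TorusRing ι)

end UFD

section ChartRing

variable [Fintype ι] {σ τ : PointedCone ℝ (ι → ℝ)}

/-- The pairing with a vector of `N_ℝ`, as a homomorphism. -/
def pairingHom (x : ι → ℝ) : (ι → ℤ) →+ ℝ where
  toFun m := pairing m x
  map_zero' := pairing_zero x
  map_add' m m' := pairing_add m m' x

variable (σ) in
/-- The inclusion of the coordinate ring of the chart of `σ` into the ring of Laurent
polynomials. -/
def toTorus : chartRing σ →+* TorusRing ι :=
  AddMonoidAlgebra.mapDomainRingHom ℂ (dualMonoid σ).subtype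

lemma toTorus_injective : Function.Injective (toTorus σ) :=
  AddMonoidAlgebra.mapDomain_injective Subtype.val_injective

instance : IsDomain (chartRing σ) := toTorus_injective.isDomain (toTorus σ)

lemma toTorus_single (m : dualMonoid σ) (c : ℂ) :
    toTorus σ (AddMonoidAlgebra.single m c) = AddMonoidAlgebra.single (m : ι → ℤ) c := by
  simp [toTorus]

lemma toTorus_chr {m : ι → ℤ} (hm : m ∈ dualMonoid σ) : toTorus σ (chr m hm) = chi m :=
  toTorus_single _ _

lemma toTorus_chartMap (h : σ ≤ τ) (r : chartRing τ) :
    toTorus σ (chartMap h r) = toTorus τ r := by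
  induction r using AddMonoidAlgebra.induction_linear with
  | zero => simp
  | add f g hf hg => rw [map_add, map_add, hf, hg, map_add]
  | single a c => rw [chartMap_single, toTorus_single, toTorus_single]; rfl

lemma coeff_toTorus (r : chartRing σ) (m : dualMonoid σ) :
    (toTorus σ r).coeff m = r.coeff m :=
  Finsupp.mapDomain_apply Subtype.val_injective _ m

lemma mem_dualMonoid_of_coeff_toTorus {r : chartRing σ} {m : ι → ℤ}
    (h : (toTorus σ r).coeff m ≠ 0) : m ∈ dualMonoid σ := by
  by_contra hm
  refine h (Finsupp.mapDomain_of_notMem_range _ _ fun hr => ?_)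
  obtain ⟨m, rfl⟩ := hr
  exact hm m.2

lemma exists_toTorus_eq {p : TorusRing ι} (hp : ∀ m, p.coeff m ≠ 0 → m ∈ dualMonoid σ) :
    ∃ r, toTorus σ r = p := by
  have : p = ∑ m ∈ p.coeff.support, AddMonoidAlgebra.single m (p.coeff m) :=
    (AddMonoidAlgebra.sum_coeff_single p).symm
  rw [this]
  refine ⟨∑ m ∈ p.coeff.support.attach, AddMonoidAlgebra.single
    ⟨m.1, hp m.1 (Finsupp.mem_support_iff.1 m.2)⟩ (p.coeff m.1), ?_⟩
  rw [map_sum, ← Finset.sum_attach p.coeff.support]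
  exact Finset.sum_congr rfl fun m _ => toTorus_single _ _

lemma chartRing_isNoetherianRing (h : (dualMonoid σ).FG) : IsNoetherianRing (chartRing σ) := by
  have : AddMonoid.FG (dualMonoid σ) := (AddMonoid.fg_iff_addSubmonoid_fg _).2 h
  exact Algebra.FiniteType.isNoetherianRing ℂ (chartRing σ)

/-- The prime ideal of the closed subset of the chart of `σ` on which all characters vanish that are
positive at the vector `x` of `σ`: it is the closure of the orbit of the face of `σ` whose relative
interior contains `x`. -/
def facePrime (x : ι → ℝ) (hx : x ∈ σ) : PrimeSpectrum (chartRing σ) where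
  asIdeal :=
    { carrier := {r | ∀ m, r.coeff m ≠ 0 → 0 < pairing m.1 x}
      zero_mem' := fun m hm => (hm rfl).elim
      add_mem' := fun {r s} hr hs m hm => by
        by_cases h : r.coeff m = 0
        · exact hs m fun h' => hm (by
            rw [AddMonoidAlgebra.coeff_add, Finsupp.add_apply, h, h', add_zero])
        · exact hr m h
      smul_mem' := fun r s hs m hm => by
        obtain ⟨a, b, -, hb, rfl⟩ := exists_add_of_mem_support_mul hm
        have := hs b hb
        have h' : pairing (a + b : dualMonoid σ).1 x = pairing a.1 x + pairing b.1 x :=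
          pairing_add _ _ _
        rw [h']
        linarith [a.2 x hx] }
  isPrime := by
    refine ⟨fun h => ?_, fun {r s} hrs => ?_⟩
    · have h1 : (1 : chartRing σ).coeff 0 ≠ 0 := by
        rw [AddMonoidAlgebra.coeff_one_zero]
        exact one_ne_zero
      have := ((Ideal.eq_top_iff_one _).1 h) 0 h1
      rw [show (0 : dualMonoid σ).1 = 0 from rfl, pairing_zero] at this
      exact lt_irrefl _ this
    · by_contra! hno
      obtain ⟨hr, hs⟩ := hno
      obtain ⟨a, ha, ha'⟩ : ∃ a, r.coeff a ≠ 0 ∧ pairing a.1 x ≤ 0 := by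
        by_contra! h
        exact hr h
      obtain ⟨b, hb, hb'⟩ : ∃ b, s.coeff b ≠ 0 ∧ pairing b.1 x ≤ 0 := by
        by_contra! h
        exact hs h
      obtain ⟨m, hm, hle⟩ := exists_weight_le
        ((pairingHom x).comp (dualMonoid σ).subtype) ha hb
      have := hrs m hm
      simp only [AddMonoidHom.comp_apply, AddSubmonoid.subtype_apply, pairingHom,
        AddMonoidHom.coe_mk, ZeroHom.coe_mk] at hle
      linarith

lemma mem_facePrime {x : ι → ℝ} {hx : x ∈ σ} {r : chartRing σ} :
    r ∈ (facePrime x hx).asIdeal ↔ ∀ m, r.coeff m ≠ 0 → 0 < pairing m.1 x := Iff.rfl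

lemma chr_mem_facePrime {x : ι → ℝ} {hx : x ∈ σ} {m : ι → ℤ} (hm : m ∈ dualMonoid σ) :
    chr m hm ∈ (facePrime x hx).asIdeal ↔ 0 < pairing m x := by
  refine ⟨fun h => h ⟨m, hm⟩ (by simp [chr]), fun h a ha => ?_⟩
  have : a = ⟨m, hm⟩ := by
    by_contra hne
    exact ha (Finsupp.single_eq_of_ne hne)
  rw [this]
  exact h

/-- The ideal of `facePrime` is generated by the characters that it contains. -/
lemma facePrime_le {x : ι → ℝ} {hx : x ∈ σ} {I : Ideal (chartRing σ)}
    (h : ∀ (m : ι → ℤ) (hm : m ∈ dualMonoid σ), 0 < pairing m x → chr m hm ∈ I) :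
    (facePrime x hx).asIdeal ≤ I := by
  intro r hr
  have : r = ∑ m ∈ r.coeff.support, AddMonoidAlgebra.single m (r.coeff m) :=
    (AddMonoidAlgebra.sum_coeff_single r).symm
  rw [this]
  refine Ideal.sum_mem _ fun m hm => ?_
  have hmI := h m.1 m.2 (hr m (Finsupp.mem_support_iff.1 hm))
  have h1 : AddMonoidAlgebra.single m (r.coeff m) =
      AddMonoidAlgebra.single 0 (r.coeff m) * chr m.1 m.2 := by
    rw [chr, AddMonoidAlgebra.single_mul_single, zero_add, mul_one]
  rw [h1]
  exact Ideal.mul_mem_left _ _ hmI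

lemma comap_facePrime (h : σ ≤ τ) {x : ι → ℝ} (hx : x ∈ σ) :
    PrimeSpectrum.comap (chartMap h) (facePrime x hx) = facePrime x (h hx) := by
  refine PrimeSpectrum.ext (Ideal.ext fun r => ?_)
  have hr : ∀ m : dualMonoid τ,
      (chartMap h r).coeff (AddSubmonoid.inclusion (dualMonoid_anti h) m) =
      r.coeff m := fun m => by
    rw [← coeff_toTorus, toTorus_chartMap, ← coeff_toTorus]
    rfl
  rw [PrimeSpectrum.comap_asIdeal, Ideal.mem_comap, mem_facePrime, mem_facePrime]
  refine ⟨fun H m hm => H _ (by rwa [hr]), fun H m hm => ?_⟩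
  rw [← coeff_toTorus, toTorus_chartMap] at hm
  have hm' := mem_dualMonoid_of_coeff_toTorus hm
  exact H ⟨m.1, hm'⟩ (by rwa [← coeff_toTorus])

/-- In the chart of a ray, the ideal of the invariant divisor is generated by any character that
takes the value one on the primitive generator of the ray. -/
lemma facePrime_eq_span {w : ι → ℤ} (hw : toReal w ∈ σ)
    (hσ : ∀ m, 0 ≤ pairing m (toReal w) → m ∈ dualMonoid σ) {e : ι → ℤ} (he : e ∈ dualMonoid σ)
    (hew : pairing e (toReal w) = 1) :
    (facePrime (toReal w) hw).asIdeal = Ideal.span {chr e he} := by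
  refine le_antisymm (facePrime_le fun m hm hmw => ?_) ?_
  · have hme : m - e ∈ dualMonoid σ := hσ _ (by
      have h0 : pairing m (toReal w) = ((∑ p, m p * w p : ℤ) : ℝ) := by simp [pairing, toReal]
      rw [h0] at hmw
      have h1 : (1 : ℝ) ≤ pairing m (toReal w) := by
        rw [h0]
        exact_mod_cast Int.add_one_le_of_lt (by exact_mod_cast hmw : 0 < ∑ p, m p * w p)
      rw [sub_eq_add_neg, pairing_add, pairing_neg, hew]
      linarith)
    refine Ideal.mem_span_singleton.2 ⟨chr (m - e) hme, ?_⟩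
    rw [chr_mul]
    congr 1
    abel
  · rw [Ideal.span_singleton_le_iff_mem, chr_mem_facePrime, hew]
    exact one_pos

/-- A factor of a function that does not vanish at the fixed point of an affine toric variety can be
normalised by a character to a regular function that does not vanish at the fixed point. -/
lemma exists_toTorus_eq_mul_chi {s : chartRing σ} {p q : TorusRing ι} (h : toTorus σ s = p * q)
    (hs : s.coeff 0 ≠ 0) : ∃ (a : ι → ℤ) (r : chartRing σ),
      toTorus σ r = p * chi a ∧ r.coeff 0 ≠ 0 := by
  rw [← coeff_toTorus, h] at hs
  obtain ⟨a, b, ha, hb, hab⟩ := exists_add_of_mem_support_mul hs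
  have hmem : ∀ m, (p * chi b).coeff m ≠ 0 → m ∈ dualMonoid σ := fun m hm x hx => by
    rw [coeff_mul_chi] at hm
    obtain ⟨m', hm', hle⟩ := exists_weight_le (pairingHom x) hm hb
    rw [← map_add, sub_add_cancel] at hle
    rw [← h] at hm'
    exact (mem_dualMonoid_of_coeff_toTorus hm' x hx).trans hle
  obtain ⟨r, hr⟩ := exists_toTorus_eq hmem
  refine ⟨b, r, hr, ?_⟩
  rw [← coeff_toTorus, hr, coeff_mul_chi]
  have : ((0 : dualMonoid σ) : ι → ℤ) - b = a := by
    rw [← hab]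
    abel
  rwa [this]

end ChartRing

end Toric

/-! ### Potentials on the ladder diagram and faces of the polytope -/

namespace GrassmannianToric

open Toric

variable {k n : ℕ}

lemma pairing_eq_form (m : Idx k n → ℤ) (x : Idx k n → ℝ) :
    pairing m x = form (fun p => (m p : ℝ)) x := rfl

/-- On a vertex a linear form is the difference of its values at the two ends of an edge of the
ladder diagram, and this remains true after a change of the values that fixes zero. -/
lemma exists_ends (a : Idx k n → ℝ) {w : Idx k n → ℤ} (hw : w ∈ vertexSet k n) :
    ∃ x y : ℝ, (y = 0 ∨ ∃ p, a p = y) ∧ form a (toReal w) = x - y ∧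
      ∀ φ : ℝ → ℤ, φ 0 = 0 → pairing (fun p => φ (a p)) (toReal w) = φ x - φ y := by
  obtain ⟨i, j, i', j', h⟩ := form_vertex hw
  refine ⟨val a i j, val a i' j', ?_, h a, fun φ hφ => ?_⟩
  · unfold val
    split_ifs with h
    · exact Or.inr ⟨_, rfl⟩
    · exact Or.inl rfl
  · have hval : ∀ i j, val (fun p => (φ (a p) : ℝ)) i j = φ (val a i j) := fun i j => by
      unfold val
      split_ifs
      · rfl
      · rw [hφ, Int.cast_zero]
    rw [pairing_eq_form, h, hval, hval]

/-- The lattice point of `M` with coordinates `c i j`, seen as the potential that takes the value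
`c i j` at the node `(i, j)` of the ladder diagram. -/
def pot (c : ℕ → ℕ → ℤ) : Idx k n → ℤ := fun p => c p.1.1 p.1.2

lemma pairing_pot_f {c : ℕ → ℕ → ℤ} {i j : ℕ} (hi : 1 ≤ i) (hi' : i ≤ k) (hj : 1 ≤ j)
    (hj' : j ≤ n - k) : pairing (pot c) (toReal (f k n i j)) = c i j := by
  have h : (i, j) ∈ Finset.Icc 1 k ×ˢ Finset.Icc 1 (n - k) := by simp; omega
  rw [pairing_eq_form, form_toReal_f, val, dif_pos h]
  rfl

lemma pairing_pot_u {c : ℕ → ℕ → ℤ} {i j : ℕ} (hi : 2 ≤ i) (hi' : i ≤ k) (hj : j < n - k) :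
    pairing (pot c) (toReal (u k n i j)) = c i (j + 1) - c (i - 1) (j + 1) := by
  rw [u, pairing_eq_form, form_toReal_sub, ← pairing_eq_form, ← pairing_eq_form,
    pairing_pot_f (by omega) hi' (by omega) (by omega),
    pairing_pot_f (by omega) (by omega) (by omega) (by omega)]

lemma pairing_pot_v {c : ℕ → ℕ → ℤ} {i j : ℕ} (hi : 1 ≤ i) (hi' : i ≤ k) (hj : 1 ≤ j)
    (hj' : j < n - k) :
    pairing (pot c) (toReal (v k n i j)) = c i (j + 1) - c i j := by
  rw [v, pairing_eq_form, form_toReal_sub, ← pairing_eq_form, ← pairing_eq_form,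
    pairing_pot_f hi hi' (by omega) (by omega), pairing_pot_f hi hi' hj (by omega)]

lemma pairing_pot_neg_f {c : ℕ → ℕ → ℤ} (hk : 1 ≤ k) (hkn : k < n) :
    pairing (pot c) (toReal (-f k n k (n - k))) = -c k (n - k) := by
  rw [pairing_eq_form, form_toReal_neg, ← pairing_eq_form,
    pairing_pot_f hk le_rfl (by omega) le_rfl]

lemma E_subset (i : ℕ) : E k n i ⊆ vertexSet k n := by
  rintro w (⟨-, rfl⟩ | ⟨h, h', j, hj, rfl⟩ | ⟨j, hj, hj', -, i', hi, hi', rfl⟩ | ⟨-, rfl⟩)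
  · exact Or.inl rfl
  · exact Or.inr (Or.inl ⟨i, j, h, h', hj, rfl⟩)
  · exact Or.inr (Or.inr (Or.inl ⟨i', j, hi, hi', hj, hj', rfl⟩))
  · exact Or.inr (Or.inr (Or.inr rfl))

lemma exists_mem_E (hk : 1 ≤ k) (hkn : k < n) {w : Idx k n → ℤ} (hw : w ∈ vertexSet k n) :
    ∃ i, 1 ≤ i ∧ i ≤ n ∧ w ∈ E k n i := by
  rcases hw with rfl | ⟨i, j, h1, h2, h3, rfl⟩ | ⟨i, j, h1, h2, h3, h4, rfl⟩ | rfl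
  · exact ⟨1, le_rfl, by omega, Or.inl ⟨rfl, rfl⟩⟩
  · exact ⟨i, by omega, by omega, Or.inr (Or.inl ⟨h1, h2, j, h3, rfl⟩)⟩
  · exact ⟨k + j, by omega, by omega, Or.inr (Or.inr (Or.inl ⟨j, h3, h4, rfl, i, h1, h2, rfl⟩))⟩
  · exact ⟨n, by omega, le_rfl, Or.inr (Or.inr (Or.inr ⟨rfl, rfl⟩))⟩

lemma E_nonempty (hk : 1 ≤ k) (hkn : k < n) {i : ℕ} (hi : 1 ≤ i) (hin : i ≤ n) :
    ∃ w, w ∈ E k n i := by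
  rcases Nat.lt_or_ge 1 i with h1 | h1
  · rcases Nat.lt_or_ge k i with h2 | h2
    · rcases Nat.lt_or_ge i n with h3 | h3
      · exact ⟨_, Or.inr (Or.inr (Or.inl
          ⟨i - k, by omega, by omega, by omega, 1, le_rfl, hk, rfl⟩))⟩
      · exact ⟨_, Or.inr (Or.inr (Or.inr ⟨by omega, rfl⟩))⟩
    · exact ⟨_, Or.inr (Or.inl ⟨h1, h2, 0, by omega, rfl⟩)⟩
  · exact ⟨_, Or.inl ⟨by omega, rfl⟩⟩

/-- The coordinates of the potential whose coboundary is the indicator of `E_i` minus that of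
`E_n`: the indicator of the nodes behind the cut `E_i`. -/
def cut (k i : ℕ) : ℕ → ℕ → ℤ := fun r s =>
  if i ≤ k then (if i ≤ r then 1 else 0) else (if i < k + s then 1 else 0)

/-- The coordinates of the potential that has the coboundary one on all edges outside `E_n`. -/
def rank : ℕ → ℕ → ℤ := fun r s => r + s - 1

lemma pairing_cut (hk : 1 ≤ k) (hkn : k < n) {i l : ℕ} (hi : 1 ≤ i) (hin : i ≤ n)
    {w : Idx k n → ℤ} (hw : w ∈ E k n l) :
    pairing (pot (cut k i)) (toReal w) = (if l = i then 1 else 0) - (if l = n then 1 else 0) := by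
  rcases hw with ⟨rfl, rfl⟩ | ⟨h, h', j, hj, rfl⟩ | ⟨j, hj, hj', rfl, i', hi, hi', rfl⟩ | ⟨rfl, rfl⟩
  · rw [pairing_pot_f le_rfl hk le_rfl (by omega)]
    simp only [cut]
    split_ifs <;> first | omega | simp
  · rw [pairing_pot_u h h' hj]
    simp only [cut]
    split_ifs <;> first | omega | simp
  · rw [pairing_pot_v hi hi' hj hj']
    simp only [cut]
    split_ifs <;> first | omega | simp
  · rw [pairing_pot_neg_f hk hkn]
    simp only [cut]
    split_ifs <;> first | omega | simp

lemma pairing_rank (hk : 1 ≤ k) (hkn : k < n) {l : ℕ} {w : Idx k n → ℤ} (hw : w ∈ E k n l) :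
    pairing (pot rank) (toReal w) = 1 - n * (if l = n then 1 else 0) := by
  rcases hw with ⟨rfl, rfl⟩ | ⟨h, h', j, hj, rfl⟩ | ⟨j, hj, hj', rfl, i', hi, hi', rfl⟩ | ⟨rfl, rfl⟩
  · rw [pairing_pot_f le_rfl hk le_rfl (by omega), if_neg (by omega)]
    simp [rank]
  · rw [pairing_pot_u h h' hj, if_neg (by omega)]
    obtain ⟨i, rfl⟩ : ∃ i, l = i + 1 := ⟨l - 1, by omega⟩
    simp [rank]
  · rw [pairing_pot_v hi hi' hj hj', if_neg (by omega)]
    simp [rank]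
  · rw [pairing_pot_neg_f hk hkn, if_pos rfl]
    simp [rank, Nat.cast_sub hkn.le]

/-- The sets `E_1, …, E_n` are disjoint. -/
lemma E_disjoint (hk : 1 ≤ k) (hkn : k < n) {i l : ℕ} (hi : 1 ≤ i) (hin : i ≤ n) (hl : 1 ≤ l)
    (hln : l ≤ n) {w : Idx k n → ℤ} (hw : w ∈ E k n i) (hw' : w ∈ E k n l) : i = l := by
  by_contra hne
  have h1 := pairing_cut hk hkn hi hin hw
  have h2 := pairing_cut hk hkn hl hln hw
  rw [pairing_cut hk hkn hi hin hw'] at h1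
  rw [pairing_cut hk hkn hl hln hw'] at h2
  rw [if_pos rfl, if_neg (Ne.symm hne)] at h1
  rw [if_pos rfl, if_neg hne] at h2
  split_ifs at h1 h2 <;> first | omega | linarith

open Classical in
lemma pairing_cut_eq (hk : 1 ≤ k) (hkn : k < n) {i : ℕ} (hi : 1 ≤ i) (hin : i ≤ n)
    {w : Idx k n → ℤ} (hw : w ∈ vertexSet k n) : pairing (pot (cut k i)) (toReal w) =
      (if w ∈ E k n i then 1 else 0) - (if w ∈ E k n n then 1 else 0) := by
  obtain ⟨l, hl, hln, hwl⟩ := exists_mem_E hk hkn hw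
  rw [pairing_cut hk hkn hi hin hwl]
  have : ∀ j, 1 ≤ j → j ≤ n → (l = j ↔ w ∈ E k n j) := fun j hj hjn =>
    ⟨fun h => h ▸ hwl, fun h => E_disjoint hk hkn hl hln hj hjn hwl h⟩
  simp only [this i hi hin, this n (by omega) le_rfl]

open Classical in
lemma pairing_rank_eq (hk : 1 ≤ k) (hkn : k < n) {w : Idx k n → ℤ} (hw : w ∈ vertexSet k n) :
    pairing (pot rank) (toReal w) = 1 - n * (if w ∈ E k n n then 1 else 0) := by
  obtain ⟨l, hl, hln, hwl⟩ := exists_mem_E hk hkn hw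
  rw [pairing_rank hk hkn hwl]
  have : l = n ↔ w ∈ E k n n :=
    ⟨fun h => h ▸ hwl, fun h => E_disjoint hk hkn hl hln (by omega) le_rfl hwl h⟩
  simp only [this]

/-- The vertices are primitive. -/
lemma exists_pairing_eq_one (hk : 1 ≤ k) (hkn : k < n) {w : Idx k n → ℤ}
    (hw : w ∈ vertexSet k n) : ∃ e, pairing e (toReal w) = 1 := by
  obtain ⟨l, hl, hln, hwl⟩ := exists_mem_E hk hkn hw
  by_cases h : l = n
  · refine ⟨-pot (cut k 1), ?_⟩
    rw [pairing_neg, pairing_cut hk hkn le_rfl (by omega) hwl, if_neg (by omega), if_pos h]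
    norm_num
  · exact ⟨pot (cut k l), by rw [pairing_cut hk hkn hl hln hwl, if_pos rfl, if_neg h, sub_zero]⟩

/-- The set of maximisers of a linear form on the polytope is a face. -/
lemma isExposed_form {a : Idx k n → ℝ} {c : ℝ} (h : ∀ w ∈ vertexSet k n, form a (toReal w) ≤ c) :
    IsExposed ℝ (polytope k n) {x | x ∈ polytope k n ∧ form a x = c} := by
  rintro ⟨x₀, hx₀, hx₀c⟩
  refine ⟨∑ p, a p • ContinuousLinearMap.proj p, ?_⟩
  have hl : ∀ x : Idx k n → ℝ,
      (∑ p, a p • (ContinuousLinearMap.proj p : (Idx k n → ℝ) →L[ℝ] ℝ)) x = form a x := fun x => by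
    simp [form]
  have hle := form_le_of_polytope h
  ext x
  simp only [hl, Set.mem_ofPred_eq]
  refine and_congr_right fun hx => ⟨fun hc y hy => hc ▸ hle y hy, fun hmax => ?_⟩
  exact le_antisymm (hle x hx) (hx₀c ▸ hmax x₀ hx₀)

lemma toReal_mem_polytope {w : Idx k n → ℤ} (hw : w ∈ vertexSet k n) :
    toReal w ∈ polytope k n := subset_convexHull ℝ _ ⟨w, hw, rfl⟩

lemma isExposed_empty : IsExposed ℝ (polytope k n) ∅ := fun h => absurd h (by simp)

lemma empty_ne_polytope : (∅ : Set (Idx k n → ℝ)) ≠ polytope k n := fun h => by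
  have : toReal (f k n 1 1) ∈ polytope k n := toReal_mem_polytope (Or.inl rfl)
  rw [← h] at this
  exact this

/-- There is a proper face that contains all vertices except the one in `E_n`. -/
lemma exists_bigFace (hk : 1 ≤ k) (hkn : k < n) : ∃ F : Set (Idx k n → ℝ),
    IsExposed ℝ (polytope k n) F ∧ F ≠ polytope k n ∧
    ∀ w ∈ vertexSet k n, toReal w ∈ F ↔ w ∉ E k n n := by
  classical
  have hn : (2 : ℝ) ≤ n := by exact_mod_cast (by omega : 2 ≤ n)
  have key : ∀ w ∈ vertexSet k n, form (fun p => (pot rank p : ℝ)) (toReal w) ≤ 1 ∧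
      (form (fun p => (pot rank p : ℝ)) (toReal w) = 1 ↔ w ∉ E k n n) := fun w hw => by
    rw [← pairing_eq_form, pairing_rank_eq hk hkn hw]
    split_ifs with h
    · simp only [h, not_true, iff_false]
      constructor
      · linarith
      · intro h'
        linarith
    · simp [h]
  refine ⟨_, isExposed_form fun w hw => (key w hw).1, fun he => ?_, fun w hw => ?_⟩
  · obtain ⟨w, hw⟩ := E_nonempty hk hkn (show 1 ≤ n by omega) le_rfl
    have := toReal_mem_polytope (E_subset n hw)
    rw [← he] at this
    exact ((key w (E_subset n hw)).2.1 this.2) hw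
  · exact ⟨fun h => (key w hw).2.1 h.2, fun h => ⟨toReal_mem_polytope hw, (key w hw).2.2 h⟩⟩

/-- Each vertex spans a ray of the fan: there is a proper face whose only vertex it is. -/
lemma exists_vertexFace (hk : 1 ≤ k) (hkn : k < n) {w : Idx k n → ℤ} (hw : w ∈ vertexSet k n) :
    ∃ F : Set (Idx k n → ℝ), IsExposed ℝ (polytope k n) F ∧ F ≠ polytope k n ∧
    ∀ w' ∈ vertexSet k n, toReal w' ∈ F ↔ w' = w := by
  classical
  have hn : (2 : ℝ) ≤ n := by exact_mod_cast (by omega : 2 ≤ n)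
  obtain ⟨i, hi, hin, hwi⟩ := exists_mem_E hk hkn hw
  -- the indicator of the head of the edge `w` separates `w` from the other edges of its cut
  obtain ⟨d, hd0, hd1, hdi⟩ : ∃ d : ℕ → ℕ → ℤ,
      0 ≤ pairing (pot d) (toReal w) ∧
      (∀ w' ∈ vertexSet k n, pairing (pot d) (toReal w') ≤ 1) ∧
      ∀ w' ∈ E k n i, w' ≠ w → pairing (pot d) (toReal w') < pairing (pot d) (toReal w) := by
    have hd1 : ∀ q : ℕ × ℕ, ∀ w' ∈ vertexSet k n,
        pairing (pot fun r s => if (r, s) = q then 1 else 0) (toReal w') ≤ 1 := by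
      rintro q w' (rfl | ⟨i, j, h1, h2, h3, rfl⟩ | ⟨i, j, h1, h2, h3, h4, rfl⟩ | rfl)
      · rw [pairing_pot_f le_rfl hk le_rfl (by omega)]
        split_ifs <;> simp
      · rw [pairing_pot_u h1 h2 h3]
        split_ifs <;> simp
      · rw [pairing_pot_v h1 h2 h3 h4]
        split_ifs <;> simp
      · rw [pairing_pot_neg_f hk hkn]
        split_ifs <;> simp
    have hz : ∀ w' : Idx k n → ℤ, pairing (pot fun _ _ => 0) (toReal w') = 0 := fun w' =>
      pairing_zero _
    have hE := fun l (hl : 1 ≤ l) (hln : l ≤ n) => E_disjoint hk hkn hi hin hl hln hwi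
    rcases hw with rfl | ⟨a, b, h1, h2, h3, rfl⟩ | ⟨a, b, h1, h2, h3, h4, rfl⟩ | rfl
    · refine ⟨fun _ _ => 0, (hz _).ge, fun w' _ => by rw [hz]; exact zero_le_one, ?_⟩
      obtain rfl := hE 1 le_rfl (by omega) (Or.inl ⟨rfl, rfl⟩)
      rintro w' (⟨-, rfl⟩ | ⟨h, -⟩ | ⟨j, hj, -, h, -⟩ | ⟨h, -⟩) hne
      · exact absurd rfl hne
      all_goals omega
    · obtain rfl := hE a (by omega) (by omega) (Or.inr (Or.inl ⟨h1, h2, b, h3, rfl⟩))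
      have hw1 : pairing (pot fun r s => if (r, s) = (i, b + 1) then 1 else 0)
          (toReal (u k n i b)) = 1 := by
        rw [pairing_pot_u h1 h2 h3, if_pos rfl, if_neg (by simp; omega)]
        simp
      refine ⟨_, hw1 ▸ zero_le_one, hd1 _, ?_⟩
      rw [hw1]
      rintro w' (⟨h, -⟩ | ⟨-, -, j, hj, rfl⟩ | ⟨j, hj, -, h, -⟩ | ⟨h, -⟩) hne
      · omega
      · have hj' : j ≠ b := by rintro rfl; exact hne rfl
        rw [pairing_pot_u h1 h2 hj, if_neg (by simp; omega)]
        split_ifs <;> simp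
      all_goals omega
    · obtain rfl := hE (k + b) (by omega) (by omega)
        (Or.inr (Or.inr (Or.inl ⟨b, h3, h4, rfl, a, h1, h2, rfl⟩)))
      have hw1 : pairing (pot fun r s => if (r, s) = (a, b + 1) then 1 else 0)
          (toReal (v k n a b)) = 1 := by
        rw [pairing_pot_v h1 h2 h3 h4, if_pos rfl, if_neg (by simp)]
        simp
      refine ⟨_, hw1 ▸ zero_le_one, hd1 _, ?_⟩
      rw [hw1]
      rintro w' (⟨h, -⟩ | ⟨h, h', -⟩ | ⟨j, hj, hj', h, c, hc, hc', rfl⟩ | ⟨h, -⟩) hne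
      · omega
      · omega
      · obtain rfl : b = j := by omega
        have hc1 : c ≠ a := by rintro rfl; exact hne rfl
        rw [pairing_pot_v hc hc' h3 h4, if_neg (by simp; omega), if_neg (by simp)]
        simp
      · omega
    · refine ⟨fun _ _ => 0, (hz _).ge, fun w' _ => by rw [hz]; exact zero_le_one, ?_⟩
      obtain rfl := hE n (by omega) le_rfl (Or.inr (Or.inr (Or.inr ⟨rfl, rfl⟩)))
      rintro w' (⟨h, -⟩ | ⟨-, h, -⟩ | ⟨j, hj, hj', h, -⟩ | ⟨-, rfl⟩) hne
      pick_goal 4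
      · exact absurd rfl hne
      all_goals omega
  -- `m` is `n - 1` on `E_i` and `-1` on the other vertices, up to the perturbation by `d`
  let m : Idx k n → ℤ := n • pot (cut k i) + -pot rank + pot d
  have hm : ∀ w' ∈ vertexSet k n, pairing m (toReal w') =
      n * (if w' ∈ E k n i then 1 else 0) - 1 + pairing (pot d) (toReal w') := fun w' hw' => by
    rw [pairing_add, pairing_add, pairing_neg, pairing_nsmul, pairing_cut_eq hk hkn hi hin hw',
      pairing_rank_eq hk hkn hw']
    ring
  have hlt : ∀ w' ∈ vertexSet k n, w' ≠ w → pairing m (toReal w') < pairing m (toReal w) :=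
    fun w' hw' hne => by
      rw [hm w' hw', hm w hw, if_pos hwi]
      split_ifs with h
      · linarith [hdi w' h hne]
      · linarith [hd1 w' hw']
  refine ⟨_, isExposed_form (a := fun p => (m p : ℝ)) (c := pairing m (toReal w))
    fun w' hw' => ?_, fun he => ?_, fun w' hw' => ⟨fun h => ?_, fun h => ?_⟩⟩
  · by_cases h : w' = w
    · rw [h]; rfl
    · exact (hlt w' hw' h).le
  · obtain ⟨l, hl, hln, hli⟩ : ∃ l, 1 ≤ l ∧ l ≤ n ∧ l ≠ i := by
      by_cases h : i = 1
      · exact ⟨2, by omega, by omega, by omega⟩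
      · exact ⟨1, by omega, by omega, Ne.symm h⟩
    obtain ⟨w', hw'⟩ := E_nonempty hk hkn hl hln
    have hne : w' ≠ w := fun h => hli (E_disjoint hk hkn hl hln hi hin hw' (h ▸ hwi))
    have := toReal_mem_polytope (E_subset l hw')
    rw [← he] at this
    exact (hlt w' (E_subset l hw') hne).ne this.2
  · by_contra hne
    exact (hlt w' hw' hne).ne h.2
  · rw [h]
    exact ⟨toReal_mem_polytope hw, rfl⟩

/-- A vertex in the cone over a face lies in the face. -/
lemma mem_face_of_mem_hull (hk : 1 ≤ k) (hkn : k < n) {F : Set (Idx k n → ℝ)}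
    (hF : IsExposed ℝ (polytope k n) F) (hne : F ≠ polytope k n) {w : Idx k n → ℤ}
    (hw : w ∈ vertexSet k n) (h : toReal w ∈ PointedCone.hull ℝ F) : toReal w ∈ F := by
  obtain ⟨G, hG, hGne, hGw⟩ := exists_vertexFace hk hkn hw
  obtain ⟨a, ha, haF⟩ := exists_form hF hne
  obtain ⟨b, hb, hbG⟩ := exists_form hG hGne
  have h1 := form_nonneg_hull (a := a - b) (s := F) (fun y hy => by
    obtain ⟨hyP, hy1⟩ := (haF y).1 hy
    rw [form_sub_left, hy1]
    linarith [hb y hyP]) _ h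
  rw [form_sub_left, ((hbG _).1 ((hGw w hw).2 rfl)).2] at h1
  have hwP := toReal_mem_polytope hw
  exact (haF _).2 ⟨hwP, le_antisymm (ha _ hwP) (by linarith)⟩

lemma mem_dualMonoid_iff {F : Set (Idx k n → ℝ)} (hF : IsExposed ℝ (polytope k n) F)
    (hne : F ≠ polytope k n) {m : Idx k n → ℤ} : m ∈ dualMonoid (PointedCone.hull ℝ F) ↔
      ∀ w ∈ vertexSet k n, toReal w ∈ F → 0 ≤ pairing m (toReal w) :=
  ⟨fun h _ _ hwF => h _ (PointedCone.subset_hull hwF), mem_dualMonoid hF hne⟩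

/-- The semigroup of the cone over a face is finitely generated: a potential that is monotone along
the edges of the face is a sum of such potentials with values `0` and `±1`. -/
lemma dualMonoid_fg {F : Set (Idx k n → ℝ)} (hF : IsExposed ℝ (polytope k n) F)
    (hne : F ≠ polytope k n) : (dualMonoid (PointedCone.hull ℝ F)).FG := by
  have hmono : ∀ φ : ℝ → ℤ, Monotone φ → φ 0 = 0 → ∀ m ∈ dualMonoid (PointedCone.hull ℝ F),
      (fun p => φ (m p)) ∈ dualMonoid (PointedCone.hull ℝ F) := fun φ hφ h0 m hm => by
    rw [mem_dualMonoid_iff hF hne] at hm ⊢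
    intro w hw hwF
    obtain ⟨x, y, -, h1, h2⟩ := exists_ends (fun p => (m p : ℝ)) hw
    have h3 := hm w hw hwF
    rw [pairing_eq_form, h1, sub_nonneg] at h3
    rw [h2 φ h0, sub_nonneg]
    exact_mod_cast hφ h3
  have hsign : ∀ x : ℤ, x < 0 ∧ x.sign = -1 ∨ x = 0 ∧ x.sign = 0 ∨ 0 < x ∧ x.sign = 1 := fun x => by
    rcases lt_trichotomy x 0 with h | h | h
    · exact Or.inl ⟨h, Int.sign_eq_neg_one_of_neg h⟩
    · exact Or.inr (Or.inl ⟨h, by rw [h, Int.sign_zero]⟩)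
    · exact Or.inr (Or.inr ⟨h, Int.sign_eq_one_of_pos h⟩)
  have hs : ∀ x y : ℤ, x ≤ y → x.sign ≤ y.sign ∧ x - x.sign ≤ y - y.sign := fun x y hxy => by
    have := hsign x
    have := hsign y
    omega
  let T : Set (Idx k n → ℤ) := {m | m ∈ dualMonoid (PointedCone.hull ℝ F) ∧
    ∀ p, m p ∈ Set.Icc (-1) 1}
  have hT : T.Finite :=
    (Set.Finite.pi' (t := fun _ => Set.Icc (-1 : ℤ) 1) fun _ => Set.finite_Icc _ _).subset
      fun m hm => hm.2
  refine (AddSubmonoid.fg_iff _).2 ⟨T, le_antisymm ?_ ?_, hT⟩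
  · exact (AddSubmonoid.closure_le).2 fun m hm => hm.1
  · suffices H : ∀ N : ℕ, ∀ m ∈ dualMonoid (PointedCone.hull ℝ F),
        ∑ p, (m p).natAbs = N → m ∈ AddSubmonoid.closure T from fun m hm => H _ m hm rfl
    intro N
    induction N using Nat.strong_induction_on with
    | _ N ih =>
      intro m hm hN
      by_cases h0 : m = 0
      · rw [h0]
        exact zero_mem _
      have hmem : (fun p => (m p).sign) ∈ T := by
        refine ⟨?_, fun p => ?_⟩
        · have := hmono (fun x => ⌊x⌋.sign) (fun x y hxy => (hs _ _ (Int.floor_mono hxy)).1)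
            (by simp) m hm
          simpa using this
        · have := hsign (m p)
          simp only [Set.mem_Icc]
          omega
      have hrest : (fun p => m p - (m p).sign) ∈ dualMonoid (PointedCone.hull ℝ F) := by
        have := hmono (fun x => ⌊x⌋ - ⌊x⌋.sign)
          (fun x y hxy => (hs _ _ (Int.floor_mono hxy)).2) (by simp) m hm
        simpa using this
      have hm' : m = (fun p => (m p).sign) + fun p => m p - (m p).sign := by
        ext p
        simp
      rw [hm']
      refine add_mem (AddSubmonoid.subset_closure hmem) (ih _ ?_ _ hrest rfl)
      rw [← hN]
      obtain ⟨q, hq⟩ := Function.ne_iff.1 h0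
      have habs : ∀ x : ℤ, (x - x.sign).natAbs ≤ x.natAbs ∧
          (x ≠ 0 → (x - x.sign).natAbs < x.natAbs) := fun x => by
        have := hsign x
        omega
      exact Finset.sum_lt_sum (fun p _ => (habs _).1) ⟨q, Finset.mem_univ q, (habs _).2 hq⟩

/-- The function `∑_{t ∈ T} (⌊x - t⌋ - ⌊-t⌋)`: it is monotone, strictly at points of `T` modulo
one, and grows by the cardinality of `T` over each unit interval. -/
def stair (T : Finset ℝ) (x : ℝ) : ℤ := ∑ t ∈ T, (⌊x - t⌋ - ⌊-t⌋)

lemma stair_zero (T : Finset ℝ) : stair T 0 = 0 := by simp [stair]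

lemma stair_add_one (T : Finset ℝ) (x : ℝ) : stair T (x + 1) = stair T x + T.card := by
  have : ∀ t ∈ T, ⌊x + 1 - t⌋ - ⌊-t⌋ = (⌊x - t⌋ - ⌊-t⌋) + 1 := fun t _ => by
    rw [show x + 1 - t = x - t + 1 by ring, Int.floor_add_one]
    ring
  rw [stair, Finset.sum_congr rfl this, Finset.sum_add_distrib]
  simp [stair]

lemma stair_lt {T : Finset ℝ} {x y : ℝ} (h : x < y) (hy : y ∈ T) : stair T x < stair T y := by
  refine Finset.sum_lt_sum (fun t _ => sub_le_sub_right (Int.floor_mono (by linarith)) _)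
    ⟨y, hy, sub_lt_sub_right ?_ _⟩
  rw [sub_self, Int.floor_zero]
  exact Int.floor_lt.2 (by push_cast; linarith)

lemma stair_lt_add_one {T : Finset ℝ} {x y : ℝ} (h : x < y + 1) (hy : y ∈ T) :
    stair T x < stair T (y + 1) := by
  have := stair_lt (x := x - 1) (by linarith) hy
  have h1 := stair_add_one T (x - 1)
  rw [sub_add_cancel] at h1
  rw [h1, stair_add_one]
  omega

open Classical in
/-- The support functions of the multiples of `D(E_i)`, on a given face: for every finite set `T` of
reals there is a potential whose coboundary on the edges of the face is `|T|` on `E_i` and zero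
elsewhere. If `T = T₀` contains all values of a certain real potential, then the
coboundary is strictly smaller than this on all edges outside the face. The potential is obtained by
applying the staircase function of `T` to this real potential, up to the coboundary of a cut. -/
lemma exists_support (hk : 1 ≤ k) (hkn : k < n) {F : Set (Idx k n → ℝ)}
    (hF : IsExposed ℝ (polytope k n) F) (hne : F ≠ polytope k n) {i : ℕ} (hi : 1 ≤ i)
    (hin : i ≤ n) : ∃ T₀ : Finset ℝ, 0 ∈ T₀ ∧ ∀ T : Finset ℝ, ∃ m : Idx k n → ℤ,
      ∀ w ∈ vertexSet k n,
        (toReal w ∈ F → pairing m (toReal w) = if w ∈ E k n i then (T.card : ℝ) else 0) ∧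
        (toReal w ∉ F → T = T₀ →
          pairing m (toReal w) < if w ∈ E k n i then (T.card : ℝ) else 0) := by
  obtain ⟨a, ha, haF⟩ := exists_form hF hne
  have hn : (0 : ℝ) < n := by exact_mod_cast (by omega : 0 < n)
  -- the coboundary of `c` is integral on the face: one on `E_n` and zero elsewhere
  let c : Idx k n → ℝ := fun p => (n : ℝ)⁻¹ * (a p - (pot rank p : ℝ))
  have hc : ∀ x, form c x = (n : ℝ)⁻¹ * (form a x - form (fun p => (pot rank p : ℝ)) x) := by
    intro x
    rw [← form_sub_left]
    simp only [form, c, Finset.mul_sum, Pi.sub_apply, mul_assoc]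
  refine ⟨insert 0 (Finset.univ.image c), Finset.mem_insert_self _ _, fun T => ?_⟩
  let m : Idx k n → ℤ := fun p => stair T (c p)
  refine ⟨m + T.card • pot (cut k i), fun w hw => ?_⟩
  rw [pairing_add, pairing_nsmul, pairing_cut_eq hk hkn hi hin hw]
  obtain ⟨x, y, hy, h1, h2⟩ := exists_ends c hw
  have hm : pairing m (toReal w) = (stair T x : ℝ) - stair T y := h2 _ (stair_zero T)
  have hwP := toReal_mem_polytope hw
  have hx : x = y + ((if w ∈ E k n n then 1 else 0) - (n : ℝ)⁻¹ * (1 - form a (toReal w))) := by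
    rw [← sub_eq_iff_eq_add', ← h1, hc, ← pairing_eq_form, pairing_rank_eq hk hkn hw]
    field_simp
    ring
  rw [hm]
  constructor
  · intro hwF
    rw [((haF _).1 hwF).2, sub_self, mul_zero, sub_zero] at hx
    rw [hx]
    split_ifs <;> simp [stair_add_one]
  · rintro hwF rfl
    have hy' : y ∈ insert 0 (Finset.univ.image c) := by
      rcases hy with rfl | ⟨p, rfl⟩
      · exact Finset.mem_insert_self _ _
      · exact Finset.mem_insert_of_mem (Finset.mem_image_of_mem _ (Finset.mem_univ _))
    have hlt : 0 < (n : ℝ)⁻¹ * (1 - form a (toReal w)) := by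
      refine mul_pos (inv_pos.2 hn) (sub_pos.2 (lt_of_le_of_ne (ha _ hwP) fun h => ?_))
      exact hwF ((haF _).2 ⟨hwP, h⟩)
    generalize (insert 0 (Finset.univ.image c) : Finset ℝ) = T at *
    have key : (stair T x : ℝ) < stair T y + (if w ∈ E k n n then (T.card : ℝ) else 0) := by
      split_ifs at hx ⊢
      · have := stair_lt_add_one (x := x) (by linarith) hy'
        rw [stair_add_one] at this
        exact_mod_cast this
      · have := stair_lt (x := x) (by linarith) hy'
        rw [add_zero]
        exact_mod_cast this
    split_ifs at key ⊢ <;> linarith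

end GrassmannianToric

/-! ### Charts of the toric variety -/

namespace Toric

variable {ι : Type} [Fintype ι] {F : Set (PointedCone ℝ (ι → ℝ))} (hF : IsGluable F)

instance isOpenImmersion_chart (σ : F) : IsOpenImmersion (chart F hF σ) := by
  have : ∀ {σ τ : F} (h : σ ⟶ τ), IsOpenImmersion ((chartDiagram F).map h) :=
    fun h => hF.isOpenImmersion h
  have := hF.isLocallyDirected
  exact inferInstanceAs (IsOpenImmersion (colimit.ι (chartDiagram F) σ))

lemma chartMap_chart {σ τ : F} (h : σ.1 ≤ τ.1) :
    Spec.map (CommRingCat.ofHom (chartMap h)) ≫ chart F hF τ = chart F hF σ :=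
  have := hF.hasColimit
  colimit.w (chartDiagram F) (homOfLE h : σ ⟶ τ)

lemma exists_chart_eq (x : toricVariety F hF) : ∃ (σ : F) (p : PrimeSpectrum (chartRing σ.1)),
    chart F hF σ p = x := by
  have : ∀ {σ τ : F} (h : σ ⟶ τ), IsOpenImmersion ((chartDiagram F).map h) :=
    fun h => hF.isOpenImmersion h
  have := hF.isLocallyDirected
  exact Scheme.IsLocallyDirected.ι_jointly_surjective (chartDiagram F) x

/-- Two charts meet in charts of common smaller cones. -/
lemma exists_of_chart_eq {σ τ : F} {p : PrimeSpectrum (chartRing σ.1)}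
    {q : PrimeSpectrum (chartRing τ.1)} (h : chart F hF σ p = chart F hF τ q) :
    ∃ ρ : F, ρ.1 ≤ σ.1 ∧ ρ.1 ≤ τ.1 ∧ ∃ r : PrimeSpectrum (chartRing ρ.1),
      chart F hF ρ r = chart F hF σ p := by
  have : ∀ {σ τ : F} (h : σ ⟶ τ), IsOpenImmersion ((chartDiagram F).map h) :=
    fun h => hF.isOpenImmersion h
  have := hF.isLocallyDirected
  obtain ⟨ρ, fi, fj, r, hr, -⟩ :=
    (Scheme.IsLocallyDirected.ι_eq_ι_iff (chartDiagram F) (i := σ) (j := τ)).1 h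
  refine ⟨ρ, leOfHom fi, leOfHom fj, r, ?_⟩
  refine (congr($(chartMap_chart hF (leOfHom fi)) r)).symm.trans ?_
  exact congrArg (chart F hF σ) hr

/-- The open cover of a toric variety by its charts. -/
def chartCover : (toricVariety F hF).OpenCover :=
  have : ∀ {σ τ : F} (h : σ ⟶ τ), IsOpenImmersion ((chartDiagram F).map h) :=
    fun h => hF.isOpenImmersion h
  have := hF.isLocallyDirected
  Scheme.IsLocallyDirected.openCover (chartDiagram F)

lemma isLocallyNoetherian_toricVariety (h : ∀ σ ∈ F, (dualMonoid σ).FG) :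
    IsLocallyNoetherian (toricVariety F hF) := by
  rw [isLocallyNoetherian_iff_openCover (chartCover hF)]
  rintro (σ : F)
  have := chartRing_isNoetherianRing (h σ.1 σ.2)
  change IsLocallyNoetherian (Spec (CommRingCat.of (chartRing σ.1)))
  infer_instance

lemma isReduced_toricVariety : IsReduced (toricVariety F hF) := by
  have (σ : (chartCover hF).I₀) : IsReduced ((chartCover hF).X σ) :=
    inferInstanceAs (IsReduced (Spec (CommRingCat.of (chartRing σ.1))))
  exact IsReduced.of_openCover _ (chartCover hF)

end Toric

namespace GrassmannianToric

open Toric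

variable (k n : ℕ)

/-- The proper faces of the polytope, the empty face included. -/
structure Face where
  /-- The points of the face. -/
  carrier : Set (Idx k n → ℝ)
  isExposed : IsExposed ℝ (polytope k n) carrier
  ne : carrier ≠ polytope k n

variable {k n}

namespace Face

/-- The cone over a proper face. -/
def cone (F : Face k n) : fan k n :=
  ⟨PointedCone.hull ℝ F.carrier, F.carrier, F.isExposed, F.ne, rfl⟩

/-- The coordinate ring of the chart of a face. -/
abbrev ring (F : Face k n) : CommRingCat.{0} := CommRingCat.of (chartRing F.cone.1)

/-- The chart of a face. -/
def chart (F : Face k n) : Spec F.ring ⟶ P k n :=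
  Toric.chart (fan k n) (fan_isGluable k n) F.cone

instance (F : Face k n) : IsOpenImmersion F.chart :=
  inferInstanceAs (IsOpenImmersion (Toric.chart (fan k n) (fan_isGluable k n) F.cone))

instance (F : Face k n) : IsDomain F.ring := inferInstanceAs (IsDomain (chartRing _))

instance (F : Face k n) : IsNoetherianRing F.ring :=
  chartRing_isNoetherianRing (dualMonoid_fg F.isExposed F.ne)

/-- The empty face. -/
def empty : Face k n := ⟨∅, isExposed_empty, empty_ne_polytope⟩

/-- The intersection of two faces. -/
def inter (F G : Face k n) : Face k n where
  carrier := F.carrier ∩ G.carrier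
  isExposed := F.isExposed.inter G.isExposed
  ne := fun he => F.ne (Set.Subset.antisymm F.isExposed.subset (he ▸ Set.inter_subset_left))

lemma cone_mono {F G : Face k n} (h : F.carrier ⊆ G.carrier) : F.cone.1 ≤ G.cone.1 :=
  Submodule.span_mono h

lemma exists_of_cone (σ : fan k n) : ∃ F : Face k n, F.cone = σ := by
  obtain ⟨_, F, hF, hne, rfl⟩ := σ
  exact ⟨⟨F, hF, hne⟩, rfl⟩

lemma chartMap_chart {F G : Face k n} (h : F.cone.1 ≤ G.cone.1) :
    Spec.map (CommRingCat.ofHom (chartMap h)) ≫ G.chart = F.chart :=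
  Toric.chartMap_chart (fan_isGluable k n) h

lemma chart_comap {F G : Face k n} (h : F.cone.1 ≤ G.cone.1)
    (q : PrimeSpectrum (chartRing F.cone.1)) :
    G.chart (PrimeSpectrum.comap (chartMap h) q) = F.chart q :=
  congr($(chartMap_chart h) q)

lemma exists_chart_eq (x : P k n) : ∃ (F : Face k n) (p : PrimeSpectrum (chartRing F.cone.1)),
    F.chart p = x := by
  obtain ⟨σ, p, h⟩ := Toric.exists_chart_eq (fan_isGluable k n) x
  obtain ⟨F, rfl⟩ := exists_of_cone σ
  exact ⟨F, p, h⟩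

lemma exists_of_chart_eq {F G : Face k n} {p : PrimeSpectrum (chartRing F.cone.1)}
    {q : PrimeSpectrum (chartRing G.cone.1)} (h : F.chart p = G.chart q) :
    ∃ H : Face k n, H.carrier ⊆ F.carrier ∧ H.carrier ⊆ G.carrier ∧
      ∃ r : PrimeSpectrum (chartRing H.cone.1), H.chart r = F.chart p := by
  obtain ⟨ρ, h1, h2, r, hr⟩ := Toric.exists_of_chart_eq (fan_isGluable k n) h
  obtain ⟨H, rfl⟩ := exists_of_cone ρ
  exact ⟨H, face_subset H.isExposed H.ne F.isExposed F.ne h1,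
    face_subset H.isExposed H.ne G.isExposed G.ne h2, r, hr⟩

lemma mem_dualMonoid_iff {F : Face k n} {m : Idx k n → ℤ} : m ∈ dualMonoid F.cone.1 ↔
    ∀ w ∈ vertexSet k n, toReal w ∈ F.carrier → 0 ≤ pairing m (toReal w) :=
  GrassmannianToric.mem_dualMonoid_iff F.isExposed F.ne

/-- A point of the chart of `F` lies in the chart of the smaller face `G` if it avoids the
invariant divisors of all vertices of `F` outside `G`. -/
lemma exists_comap_eq {G F : Face k n} (h : G.carrier ⊆ F.carrier)
    (p : PrimeSpectrum (chartRing F.cone.1))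
    (hp : ∀ w ∈ vertexSet k n, toReal w ∈ F.carrier → toReal w ∉ G.carrier →
      ∃ (m : Idx k n → ℤ) (hm : m ∈ dualMonoid F.cone.1),
        0 < pairing m (toReal w) ∧ chr m hm ∉ p.asIdeal) :
    ∃ q, PrimeSpectrum.comap (chartMap (cone_mono h)) q = p := by
  classical
  have hfin := vertexSet_finite (k := k) (n := n)
  -- a character that does not vanish at `p` and is positive on all vertices outside `G`
  have hsum : ∀ W : Finset (Idx k n → ℤ), (∀ w ∈ W, w ∈ vertexSet k n ∧ toReal w ∈ F.carrier ∧
      toReal w ∉ G.carrier) → ∃ (m : Idx k n → ℤ) (hm : m ∈ dualMonoid F.cone.1),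
        chr m hm ∉ p.asIdeal ∧ ∀ w ∈ W, 0 < pairing m (toReal w) := by
    intro W
    induction W using Finset.induction_on with
    | empty =>
      refine fun _ => ⟨0, zero_mem _, fun h1 => p.isPrime.ne_top ?_, by simp⟩
      exact (Ideal.eq_top_iff_one _).2 h1
    | insert w W _ ih =>
      intro hW
      obtain ⟨m, hm, hmp, hmW⟩ := ih fun w' hw' => hW w' (Finset.mem_insert_of_mem hw')
      obtain ⟨hw, hwF, hwG⟩ := hW w (Finset.mem_insert_self w W)
      obtain ⟨m', hm', hpos, hmp'⟩ := hp w hw hwF hwG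
      refine ⟨m + m', add_mem hm hm', ?_, fun w' hw' => ?_⟩
      · rw [← chr_mul hm hm']
        exact p.isPrime.mul_notMem hmp hmp'
      · rw [pairing_add]
        rcases Finset.mem_insert.1 hw' with rfl | hw''
        · exact add_pos_of_nonneg_of_pos (hm _ (PointedCone.subset_hull hwF)) hpos
        · obtain ⟨-, hwF', -⟩ := hW w' hw'
          exact add_pos_of_pos_of_nonneg (hmW w' hw'') (hm' _ (PointedCone.subset_hull hwF'))
  obtain ⟨m, hm, hmp, hmpos⟩ := hsum
    (hfin.toFinset.filter fun w => toReal w ∈ F.carrier ∧ toReal w ∉ G.carrier)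
    (fun w hw => by simpa using hw)
  obtain ⟨m₁, h0, h1⟩ := exists_pairing G.isExposed G.ne F.isExposed F.ne h
  have hc : CutsOut m₁ G.cone.1 F.cone.1 := cutsOut G.isExposed G.ne F.isExposed F.ne h h0 h1
  -- `N` is so large that `N m - m₁` is nonnegative on all vertices of `F`
  let N : ℕ := ∑ w ∈ hfin.toFinset, (∑ q, m₁ q * w q).natAbs
  have hN : -m₁ + N • m ∈ dualMonoid F.cone.1 := mem_dualMonoid_iff.2 fun w hw hwF => by
    rw [pairing_add, pairing_nsmul, pairing_neg]
    by_cases hwG : toReal w ∈ G.carrier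
    · rw [h0 w hw hwG, neg_zero, zero_add]
      exact mul_nonneg (Nat.cast_nonneg _) (hm _ (PointedCone.subset_hull hwF))
    · have hpos := hmpos w (by simp [hw, hwF, hwG])
      rw [pairing_toReal] at hpos ⊢
      rw [pairing_toReal]
      have hle : (∑ q, m₁ q * w q).natAbs ≤ N :=
        Finset.single_le_sum (f := fun w => (∑ q, m₁ q * w q).natAbs) (fun _ _ => Nat.zero_le _)
          (hfin.mem_toFinset.2 hw)
      have hpos' : 1 ≤ ∑ q, m q * w q := by exact_mod_cast hpos
      have : 0 ≤ -(∑ q, m₁ q * w q) + (N : ℤ) * ∑ q, m q * w q := by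
        have : (N : ℤ) ≤ N * ∑ q, m q * w q := by nlinarith
        omega
      exact_mod_cast this
  refine hc.exists_preimage p fun hmem => ?_
  have hpow : chr m hm ^ N ∈ p.asIdeal := by
    have : chr m hm ^ N = chr m₁ hc.mem * chr _ hN := by
      rw [chr_pow, chr_mul]
      congr 1
      abel
    rw [this]
    exact Ideal.mul_mem_right _ _ hmem
  exact hmp (p.isPrime.mem_of_pow_mem _ hpow)

end Face

instance : IsLocallyNoetherian (P k n) :=
  isLocallyNoetherian_toricVariety _ fun _ ⟨_, hF, hne, h⟩ => h ▸ dualMonoid_fg hF hne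

/-- The toric variety is covered by finitely many charts, since the chart of a face depends only on
the vertices of the face. -/
instance : CompactSpace (P k n) := by
  classical
  -- the charts of two faces with the same vertices have the same image
  have hle : ∀ F G : Face k n, (∀ w ∈ vertexSet k n, toReal w ∈ F.carrier → toReal w ∈ G.carrier) →
      Set.range F.chart ⊆ Set.range G.chart := by
    rintro F G h _ ⟨p, rfl⟩
    obtain ⟨q, rfl⟩ := Face.exists_comap_eq (G := F.inter G) (F := F) Set.inter_subset_left p
      fun w hw hwF hwG => (hwG ⟨hwF, h w hw hwF⟩).elim
    refine ⟨PrimeSpectrum.comap (chartMap (Face.cone_mono Set.inter_subset_right)) q, ?_⟩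
    rw [Face.chart_comap]
    exact (Face.chart_comap _ q).symm
  let S : Set (Set (Idx k n → ℤ)) := {V | V ⊆ vertexSet k n ∧
    ∃ F : Face k n, V = {w ∈ vertexSet k n | toReal w ∈ F.carrier}}
  have hS : S.Finite := vertexSet_finite.finite_subsets.subset fun V hV => hV.1
  have hc : IsCompact (⋃ V ∈ S, ⋃ F : {F : Face k n // V = {w ∈ vertexSet k n |
      toReal w ∈ F.carrier}}, Set.range F.1.chart) := by
    refine hS.isCompact_biUnion fun V hV => ?_
    obtain ⟨-, F, hF⟩ := hV
    have : (⋃ F : {F : Face k n // V = {w ∈ vertexSet k n | toReal w ∈ F.carrier}},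
        Set.range F.1.chart) = Set.range F.chart := by
      refine Set.Subset.antisymm (Set.iUnion_subset fun G => hle _ _ fun w hw hwG => ?_)
        (Set.subset_iUnion_of_subset ⟨F, hF⟩ subset_rfl)
      have : w ∈ V := by
        rw [G.2]
        exact ⟨hw, hwG⟩
      rw [hF] at this
      exact this.2
    rw [this]
    exact isCompact_range F.chart.continuous
  refine ⟨?_⟩
  convert hc
  refine (Set.eq_univ_of_forall fun x => ?_).symm
  obtain ⟨F, p, rfl⟩ := Face.exists_chart_eq x
  simp only [Set.mem_iUnion]
  exact ⟨_, ⟨fun w hw => hw.1, F, rfl⟩, ⟨F, rfl⟩, p, rfl⟩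

variable (k n) in
/-- The inclusion of the torus into the toric variety, as the chart of the empty face. -/
def torus : Spec (CommRingCat.of (TorusRing (Idx k n))) ⟶ P k n :=
  Spec.map (CommRingCat.ofHom (toTorus (Face.empty : Face k n).cone.1)) ≫ Face.empty.chart

instance isIso_toTorus_empty :
    IsIso (CommRingCat.ofHom (toTorus (Face.empty : Face k n).cone.1)) :=
  (ConcreteCategory.isIso_iff_bijective _).2
    ⟨toTorus_injective, fun _ => exists_toTorus_eq fun _ _ =>
      Face.mem_dualMonoid_iff.2 fun _ _ h => h.elim⟩

instance : IsOpenImmersion (torus k n) := by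
  unfold torus
  infer_instance

lemma toTorus_chart (F : Face k n) :
    Spec.map (CommRingCat.ofHom (toTorus F.cone.1)) ≫ F.chart = torus k n := by
  have h : (Face.empty : Face k n).cone.1 ≤ F.cone.1 := Face.cone_mono (Set.empty_subset _)
  have e : CommRingCat.ofHom (toTorus F.cone.1) =
      CommRingCat.ofHom (chartMap h) ≫ CommRingCat.ofHom (toTorus Face.empty.cone.1) :=
    CommRingCat.hom_ext (RingHom.ext fun r => (toTorus_chartMap h r).symm)
  rw [e, Spec.map_comp, Category.assoc, Face.chartMap_chart]
  rfl

/-- The generic point of the torus is a generic point of every chart. -/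
lemma torus_bot_specializes (x : P k n) :
    torus k n (⊥ : PrimeSpectrum (TorusRing (Idx k n))) ⤳ x := by
  obtain ⟨F, p, rfl⟩ := Face.exists_chart_eq x
  have h := congr($(toTorus_chart F) (⊥ : PrimeSpectrum (TorusRing (Idx k n))))
  have h0 : Spec.map (CommRingCat.ofHom (toTorus F.cone.1))
      (⊥ : PrimeSpectrum (TorusRing (Idx k n))) = (⊥ : PrimeSpectrum (chartRing F.cone.1)) := by
    refine PrimeSpectrum.ext ((RingHom.injective_iff_ker_eq_bot _).1 toTorus_injective)
  rw [← h]
  refine Specializes.map (f := F.chart) ?_ F.chart.continuous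
  refine (PrimeSpectrum.le_iff_specializes _ p).1 ?_
  erw [h0]
  exact bot_le

instance : IsIntegral (P k n) := by
  have : IsReduced (P k n) := isReduced_toricVariety _
  have h : closure {torus k n (⊥ : PrimeSpectrum (TorusRing (Idx k n)))} = Set.univ :=
    Set.eq_univ_of_forall fun x => (torus_bot_specializes x).mem_closure
  have : IrreducibleSpace (P k n) := by
    refine (irreducibleSpace_def _).2 ?_
    rw [Set.top_eq_univ, ← h]
    exact isIrreducible_singleton.closure
  exact isIntegral_of_irreducibleSpace_of_isReduced _

end GrassmannianToric

/-! ### The torus invariant prime divisors -/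

namespace GrassmannianToric

open Toric DivisorTheory AlgebraicGeometry.Scheme

variable {k n : ℕ}

open Classical in
/-- The generic point of the torus invariant prime divisor of the ray spanned by the vertex `w`.
It is read off in the chart of any face that contains `w`; the value is irrelevant if there is no
such face. -/
def rayPoint (w : Idx k n → ℤ) : P k n :=
  if h : ∃ F : Face k n, toReal w ∈ F.carrier then
    h.choose.chart (facePrime (toReal w) (PointedCone.subset_hull h.choose_spec))
  else torus k n (⊥ : PrimeSpectrum (TorusRing (Idx k n)))

lemma Face.mem_cone {F : Face k n} {x : Idx k n → ℝ} (hx : x ∈ F.carrier) : x ∈ F.cone.1 :=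
  PointedCone.subset_hull hx

lemma rayPoint_eq_chart {F : Face k n} {w : Idx k n → ℤ} (hw : toReal w ∈ F.carrier) :
    rayPoint w = F.chart (facePrime (toReal w) (Face.mem_cone hw)) := by
  have h : ∃ F : Face k n, toReal w ∈ F.carrier := ⟨F, hw⟩
  have key : ∀ {G H : Face k n} (hGH : G.carrier ⊆ H.carrier) (hG : toReal w ∈ G.carrier),
      G.chart (facePrime (toReal w) (Face.mem_cone hG)) =
        H.chart (facePrime (toReal w) (Face.mem_cone (hGH hG))) := fun {G H} hGH hG => by
    have h1 := comap_facePrime (Face.cone_mono hGH) (Face.mem_cone hG)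
    rw [← Face.chart_comap (Face.cone_mono hGH), h1]
  rw [rayPoint, dif_pos h]
  have h1 := key (G := h.choose.inter F) Set.inter_subset_left ⟨h.choose_spec, hw⟩
  have h2 := key (G := h.choose.inter F) (H := F) Set.inter_subset_right ⟨h.choose_spec, hw⟩
  exact h1.symm.trans h2

lemma Face.chart_injective (F : Face k n) : Function.Injective F.chart :=
  F.chart.isOpenEmbedding.injective

lemma Face.chart_specializes_iff {F : Face k n} {p q : PrimeSpectrum (chartRing F.cone.1)} :
    F.chart p ⤳ F.chart q ↔ p.asIdeal ≤ q.asIdeal :=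
  F.chart.isOpenEmbedding.isInducing.specializes_iff.trans
    (PrimeSpectrum.le_iff_specializes p q).symm

/-- A point that specializes to a point of a chart lies in the chart. -/
lemma Face.exists_of_specializes {F : Face k n} {p : PrimeSpectrum (chartRing F.cone.1)} {x : P k n}
    (h : x ⤳ F.chart p) : ∃ q : PrimeSpectrum (chartRing F.cone.1), F.chart q = x :=
  h.mem_open F.chart.isOpenEmbedding.isOpen_range ⟨p, rfl⟩

lemma exists_face_of_vertex (hk : 1 ≤ k) (hkn : k < n) {w : Idx k n → ℤ} (hw : w ∈ vertexSet k n) :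
    ∃ F : Face k n, ∀ w' ∈ vertexSet k n, toReal w' ∈ F.carrier ↔ w' = w := by
  obtain ⟨F, hF, hne, h⟩ := exists_vertexFace hk hkn hw
  exact ⟨⟨F, hF, hne⟩, h⟩

/-- The generic point of an invariant divisor lies in the charts of those faces only that contain
the vertex: in other charts some character of positive weight is invertible. -/
lemma mem_of_chart_eq_rayPoint (hk : 1 ≤ k) (hkn : k < n) {w : Idx k n → ℤ}
    (hw : w ∈ vertexSet k n) {G : Face k n} {q : PrimeSpectrum (chartRing G.cone.1)}
    (h : G.chart q = rayPoint w) : toReal w ∈ G.carrier := by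
  obtain ⟨F, hF⟩ := exists_face_of_vertex hk hkn hw
  have hwF : toReal w ∈ F.carrier := (hF w hw).2 rfl
  rw [rayPoint_eq_chart hwF] at h
  obtain ⟨H, hHF, hHG, r, hr⟩ := Face.exists_of_chart_eq h.symm
  refine hHG ?_
  by_contra hwH
  obtain ⟨m, h0, h1⟩ := exists_pairing H.isExposed H.ne F.isExposed F.ne hHF
  have hc : CutsOut m H.cone.1 F.cone.1 := cutsOut H.isExposed H.ne F.isExposed F.ne hHF h0 h1
  have hr' : PrimeSpectrum.comap (chartMap hc.le) r = facePrime (toReal w) (Face.mem_cone hwF) :=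
    F.chart_injective ((Face.chart_comap hc.le r).trans hr)
  have := hc.notMem r
  rw [hr', chr_mem_facePrime] at this
  exact this (h1 w hw hwF hwH)

lemma rayPoint_injOn (hk : 1 ≤ k) (hkn : k < n) {w w' : Idx k n → ℤ} (hw : w ∈ vertexSet k n)
    (hw' : w' ∈ vertexSet k n) (h : rayPoint w = rayPoint w') : w = w' := by
  obtain ⟨F, hF⟩ := exists_face_of_vertex hk hkn hw'
  have hwF : toReal w' ∈ F.carrier := (hF w' hw').2 rfl
  rw [rayPoint_eq_chart hwF] at h
  exact (hF w hw).1 (mem_of_chart_eq_rayPoint hk hkn hw h.symm)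

lemma rayPoint_specializes_iff {F : Face k n} {w : Idx k n → ℤ} (hwF : toReal w ∈ F.carrier)
    (p : PrimeSpectrum (chartRing F.cone.1)) : rayPoint w ⤳ F.chart p ↔
      ∀ (m : Idx k n → ℤ) (hm : m ∈ dualMonoid F.cone.1), 0 < pairing m (toReal w) →
        chr m hm ∈ p.asIdeal := by
  rw [rayPoint_eq_chart hwF, Face.chart_specializes_iff]
  exact ⟨fun h m hm hpos => h ((chr_mem_facePrime hm).2 hpos), facePrime_le⟩

lemma rayDivisor_eq_closure (hk : 1 ≤ k) (hkn : k < n) {w : Idx k n → ℤ} (hw : w ∈ vertexSet k n) :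
    rayDivisor (fan k n) (fan_isGluable k n) w = closure {rayPoint w} := by
  refine Set.ext fun (x : P k n) => Iff.trans ?_ specializes_iff_mem_closure
  refine Set.mem_iUnion₂.trans ?_
  constructor
  · rintro ⟨σ, hσ, p, hp, rfl⟩
    obtain ⟨F, rfl⟩ := Face.exists_of_cone σ
    exact (rayPoint_specializes_iff (mem_face_of_mem_hull hk hkn F.isExposed F.ne hw hσ) p).2 hp
  · intro h
    obtain ⟨F, p, rfl⟩ := Face.exists_chart_eq x
    obtain ⟨q, hq⟩ := Face.exists_of_specializes h
    have hwF := mem_of_chart_eq_rayPoint hk hkn hw hq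
    exact ⟨F.cone, Face.mem_cone hwF, p, (rayPoint_specializes_iff hwF p).1 h, rfl⟩

open Classical in
lemma D_apply (hk : 1 ≤ k) (hkn : k < n) (i : ℕ) (y : P k n) :
    D k n i y = if ∃ w ∈ E k n i, y = rayPoint w then 1 else 0 := by
  have h : (∃ w ∈ E k n i, IsGenericPoint y (rayDivisor (fan k n) (fan_isGluable k n) w)) ↔
      ∃ w ∈ E k n i, y = rayPoint w := by
    refine exists_congr fun w => and_congr_right fun hw => ?_
    rw [rayDivisor_eq_closure hk hkn (E_subset i hw)]
    refine ⟨fun h => h.eq isGenericPoint_closure, ?_⟩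
    rintro rfl
    exact isGenericPoint_closure
  refine Eq.trans ?_ (if_congr h rfl rfl)
  rfl

open Classical in
lemma D_rayPoint (hk : 1 ≤ k) (hkn : k < n) (i : ℕ) {w : Idx k n → ℤ} (hw : w ∈ vertexSet k n) :
    D k n i (rayPoint w) = if w ∈ E k n i then 1 else 0 := by
  rw [D_apply hk hkn]
  refine if_congr ⟨?_, fun h => ⟨w, h, rfl⟩⟩ rfl rfl
  rintro ⟨w', hw', h⟩
  rwa [rayPoint_injOn hk hkn hw (E_subset i hw') h]

lemma D_eq_zero (hk : 1 ≤ k) (hkn : k < n) (i : ℕ) {y : P k n}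
    (hy : ∀ w ∈ vertexSet k n, y ≠ rayPoint w) : D k n i y = 0 := by
  rw [D_apply hk hkn, if_neg]
  rintro ⟨w, hw, h⟩
  exact hy w (E_subset i hw) h

lemma Face.exists_torus_eq (q : PrimeSpectrum (chartRing (Face.empty : Face k n).cone.1)) :
    ∃ p : PrimeSpectrum (TorusRing (Idx k n)), torus k n p = Face.empty.chart q := by
  obtain ⟨p, hp⟩ := (Spec.map (CommRingCat.ofHom
    (toTorus (Face.empty : Face k n).cone.1))).surjective q
  exact ⟨p, congrArg Face.empty.chart hp⟩

/-- A point of a chart outside the torus lies on the invariant divisor of a vertex. -/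
lemma exists_torus_eq_or (y : P k n) : (∃ p : PrimeSpectrum (TorusRing (Idx k n)),
    torus k n p = y) ∨ ∃ w ∈ vertexSet k n, ∃ F : Face k n, toReal w ∈ F.carrier ∧
      rayPoint w ⤳ y := by
  obtain ⟨F, p, rfl⟩ := Face.exists_chart_eq y
  by_cases h : ∃ w ∈ vertexSet k n, toReal w ∈ F.carrier ∧ rayPoint w ⤳ F.chart p
  · obtain ⟨w, hw, hwF, hp⟩ := h
    exact Or.inr ⟨w, hw, F, hwF, hp⟩
  · obtain ⟨q, rfl⟩ := Face.exists_comap_eq (G := Face.empty) (Set.empty_subset _) p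
      fun w hw hwF _ => by
        by_contra! hno
        exact h ⟨w, hw, hwF, (rayPoint_specializes_iff hwF p).2 hno⟩
    rw [Face.chart_comap]
    exact Or.inl (Face.exists_torus_eq q)

lemma chr_ne_zero {σ : PointedCone ℝ (Idx k n → ℝ)} {m : Idx k n → ℤ} (hm : m ∈ dualMonoid σ) :
    chr m hm ≠ 0 := fun h => by
  have h2 := toTorus_chr hm
  rw [h, map_zero] at h2
  exact (isUnit_chi m).ne_zero h2.symm

/-- In the chart of a vertex `w` the invariant divisor is principal. -/
lemma exists_span_eq (hk : 1 ≤ k) (hkn : k < n) {w : Idx k n → ℤ} (hw : w ∈ vertexSet k n) :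
    ∃ (F : Face k n) (hwF : toReal w ∈ F.cone.1), rayPoint w = F.chart (facePrime (toReal w) hwF) ∧
      (∀ m, 0 ≤ pairing m (toReal w) → m ∈ dualMonoid F.cone.1) ∧
      ∃ (e : Idx k n → ℤ) (he : e ∈ dualMonoid F.cone.1), pairing e (toReal w) = 1 ∧
        (facePrime (toReal w) hwF).asIdeal = Ideal.span {chr e he} := by
  obtain ⟨F, hF⟩ := exists_face_of_vertex hk hkn hw
  have hwF : toReal w ∈ F.carrier := (hF w hw).2 rfl
  have hm : ∀ m, 0 ≤ pairing m (toReal w) → m ∈ dualMonoid F.cone.1 := fun m hm =>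
    Face.mem_dualMonoid_iff.2 fun w' hw' hw'F => by rwa [(hF w' hw').1 hw'F]
  obtain ⟨e, he⟩ := exists_pairing_eq_one hk hkn hw
  exact ⟨F, Face.mem_cone hwF, rayPoint_eq_chart hwF, hm, e, hm e (he ▸ zero_le_one), he,
    facePrime_eq_span _ hm _ he⟩

/-- The invariant divisors have codimension one. -/
lemma coheight_rayPoint (hk : 1 ≤ k) (hkn : k < n) {w : Idx k n → ℤ} (hw : w ∈ vertexSet k n) :
    Order.coheight (rayPoint w) = 1 := by
  obtain ⟨F, hwF, hη, -, e, he, -, hspan⟩ := exists_span_eq hk hkn hw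
  rw [hη]
  exact coheight_eq_one_of_span F.chart _ (chr_ne_zero he) hspan

/-- The points of codimension one lie in the torus or are generic points of invariant divisors. -/
lemma exists_torus_eq_or_eq_rayPoint (hk : 1 ≤ k) (hkn : k < n) {y : P k n}
    (hy : Order.coheight y = 1) : (∃ p : PrimeSpectrum (TorusRing (Idx k n)),
    torus k n p = y) ∨ ∃ w ∈ vertexSet k n, y = rayPoint w := by
  refine (exists_torus_eq_or y).imp_right ?_
  rintro ⟨w, hw, -, -, h⟩
  refine ⟨w, hw, ?_⟩
  obtain ⟨F, p, rfl⟩ := Face.exists_chart_eq y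
  obtain ⟨q, hq⟩ := Face.exists_of_specializes h
  have hη := coheight_rayPoint hk hkn hw
  rw [← hq] at h hη ⊢
  rw [Face.chart_specializes_iff] at h
  have hp : p.asIdeal.IsPrime := p.isPrime
  have hq : q.asIdeal.IsPrime := q.isPrime
  refine congrArg F.chart (PrimeSpectrum.ext ?_)
  by_contra hne
  have h1 := Ideal.height_add_one_le_of_lt_of_isPrime (lt_of_le_of_ne h (Ne.symm hne))
  have hy' : p.asIdeal.height = 1 := (coheight_chart F.chart p).symm.trans hy
  have hη' : q.asIdeal.height = 1 := (coheight_chart F.chart q).symm.trans hη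
  rw [hy', hη'] at h1
  exact absurd h1 (by decide)

/-! ### Characters as rational functions -/

/-- The Laurent polynomials, as rational functions on the toric variety. -/
def lau : TorusRing (Idx k n) →+* (P k n).functionField := ratFun (torus k n)

lemma lau_injective : Function.Injective (lau (k := k) (n := n)) := ratFun_injective (torus k n)

lemma lau_chi_ne_zero (m : Idx k n → ℤ) : lau (chi m) ≠ 0 :=
  (map_ne_zero_iff _ lau_injective).2 (isUnit_chi m).ne_zero

lemma lau_toTorus (F : Face k n) (r : chartRing F.cone.1) :
    lau (toTorus F.cone.1 r) = ratFun F.chart r :=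
  ratFun_comp F.chart (torus k n) (CommRingCat.ofHom (toTorus F.cone.1)) (toTorus_chart F) r

/-- The order of vanishing of a character depends additively on the character. -/
def charOrd (y : P k n) : (Idx k n → ℤ) →+ ℤ where
  toFun m := ord (lau (chi m)) y
  map_zero' := by
    rw [chi_zero, map_one]
    exact ord_one y
  map_add' m m' := by
    rw [← chi_mul, map_mul]
    exact ord_mul (lau_chi_ne_zero m) (lau_chi_ne_zero m')

/-- The order of vanishing of a character along an invariant divisor is given by the pairing. -/
lemma ord_chi_rayPoint (hk : 1 ≤ k) (hkn : k < n) {w : Idx k n → ℤ} (hw : w ∈ vertexSet k n)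
    (m : Idx k n → ℤ) : (ord (lau (chi m)) (rayPoint w) : ℝ) = pairing m (toReal w) := by
  obtain ⟨F, hwF, hη, hmem, e, he, hew, hspan⟩ := exists_span_eq hk hkn hw
  -- `χ^e` is a uniformizer, and the characters of weight zero are units at the generic point
  have h1 : charOrd (rayPoint w) e = 1 := by
    change ord (lau (chi e)) (rayPoint w) = 1
    rw [← toTorus_chr he, lau_toTorus, hη]
    exact ord_ratFun_eq_one F.chart _ (chr_ne_zero he) hspan
  have h0 : ∀ m, pairing m (toReal w) = 0 → charOrd (rayPoint w) m = 0 := fun m hm => by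
    change ord (lau (chi m)) (rayPoint w) = 0
    rw [← toTorus_chr (hmem m hm.ge), lau_toTorus, hη]
    refine ord_ratFun_eq_zero F.chart _ fun h => ?_
    exact ((chr_mem_facePrime _).1 h).ne' hm
  let a : ℤ := ∑ p, m p * w p
  have ha : pairing m (toReal w) = a := pairing_toReal m w
  have hz : pairing (m - a • e) (toReal w) = 0 := by
    have : pairing (a • e) (toReal w) = a * pairing e (toReal w) :=
      map_zsmul (pairingHom (toReal w)) a e |>.trans (zsmul_eq_mul _ _)
    rw [sub_eq_add_neg, pairing_add, pairing_neg, this, hew, ha, mul_one, add_neg_cancel]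
  have hm : charOrd (rayPoint w) m = a := by
    have := h0 _ hz
    rw [map_sub, map_zsmul, h1, smul_eq_mul, mul_one, sub_eq_zero] at this
    exact this
  rw [ha]
  exact congrArg Int.cast hm

lemma ord_lau_torus (p : PrimeSpectrum (TorusRing (Idx k n))) {r : TorusRing (Idx k n)}
    (h : r ∉ p.asIdeal) : ord (lau r) (torus k n p) = 0 :=
  ord_ratFun_eq_zero (torus k n) p h

lemma ord_chi_torus (p : PrimeSpectrum (TorusRing (Idx k n))) (m : Idx k n → ℤ) :
    ord (lau (chi m)) (torus k n p) = 0 :=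
  ord_lau_torus p fun h => p.isPrime.ne_top (Ideal.eq_top_of_isUnit_mem _ h (isUnit_chi m))

lemma ord_chi_eq_zero (hk : 1 ≤ k) (hkn : k < n) {y : P k n}
    (hy : ∀ w ∈ vertexSet k n, y ≠ rayPoint w) (m : Idx k n → ℤ) : ord (lau (chi m)) y = 0 := by
  by_cases hc : Order.coheight y = 1
  · rcases exists_torus_eq_or_eq_rayPoint hk hkn hc with ⟨p, rfl⟩ | ⟨w, hw, rfl⟩
    · exact ord_chi_torus p m
    · exact (hy w hw rfl).elim
  · exact ord_eq_zero_of_coheight_neq_one hc _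

end GrassmannianToric

/-! ### The divisors `D(E_i)` are Cartier, linearly equivalent and ample -/

namespace GrassmannianToric

open Toric DivisorTheory AlgebraicGeometry.Scheme

variable {k n : ℕ}

/-- The local equation of `D(E_i)` on the chart of a face is a character. -/
lemma D_mem_cartierDivisors (hk : 1 ≤ k) (hkn : k < n) {i : ℕ} (hi : 1 ≤ i) (hin : i ≤ n) :
    D k n i ∈ cartierDivisors (P k n) := by
  classical
  intro x
  obtain ⟨F, p, rfl⟩ := Face.exists_chart_eq x
  obtain ⟨_, -, hT⟩ := exists_support hk hkn F.isExposed F.ne hi hin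
  obtain ⟨m, hm⟩ := hT {0}
  refine ⟨F.chart.opensRange, ⟨p, rfl⟩, lau (chi m), lau_chi_ne_zero m, ?_⟩
  rintro _ ⟨q, rfl⟩
  by_cases hy : ∃ w ∈ vertexSet k n, F.chart q = rayPoint w
  · obtain ⟨w, hw, hq⟩ := hy
    rw [hq, D_rayPoint hk hkn i hw]
    have h1 := (hm w hw).1 (mem_of_chart_eq_rayPoint hk hkn hw hq)
    rw [← ord_chi_rayPoint hk hkn hw, Finset.card_singleton, Nat.cast_one] at h1
    exact_mod_cast h1.symm
  · push Not at hy
    rw [D_eq_zero hk hkn i hy, ord_chi_eq_zero hk hkn hy]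

/-- The function is the character whose coboundary is the difference of two cuts. -/
lemma D_sub_D_mem_principalDivisors (hk : 1 ≤ k) (hkn : k < n) {i j : ℕ} (hi : 1 ≤ i)
    (hin : i ≤ n) (hj : 1 ≤ j) (hjn : j ≤ n) : D k n i - D k n j ∈ principalDivisors (P k n) := by
  classical
  refine ⟨lau (chi (pot (cut k i) - pot (cut k j))), lau_chi_ne_zero _, fun y => ?_⟩
  change D k n i y - D k n j y = _
  by_cases hy : ∃ w ∈ vertexSet k n, y = rayPoint w
  · obtain ⟨w, hw, rfl⟩ := hy
    rw [D_rayPoint hk hkn i hw, D_rayPoint hk hkn j hw]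
    have h := ord_chi_rayPoint hk hkn hw (pot (cut k i) - pot (cut k j))
    rw [sub_eq_add_neg, pairing_add, pairing_neg, pairing_cut_eq hk hkn hi hin hw,
      pairing_cut_eq hk hkn hj hjn hw, neg_sub, sub_add_sub_cancel] at h
    exact_mod_cast h.symm
  · push Not at hy
    rw [D_eq_zero hk hkn i hy, D_eq_zero hk hkn j hy, ord_chi_eq_zero hk hkn hy, sub_zero]

/-- A support function that is linear on the cone over a face, and strictly smaller outside of it,
gives an effective divisor in a multiple of the class of `D(E_i)` whose support is the complement of
the chart of the face. -/
lemma isAmple_D (hk : 1 ≤ k) (hkn : k < n) {i : ℕ} (hi : 1 ≤ i) (hin : i ≤ n) :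
    IsAmple ⟨D k n i, D_mem_cartierDivisors hk hkn hi hin⟩ := by
  classical
  refine ⟨inferInstance, fun x => ?_⟩
  obtain ⟨F, p, rfl⟩ := Face.exists_chart_eq x
  obtain ⟨T, hT0, hT⟩ := exists_support hk hkn F.isExposed F.ne hi hin
  obtain ⟨m, hm⟩ := hT T
  have hzero : ∀ y : P k n, (∀ w ∈ vertexSet k n, y ≠ rayPoint w) →
      ord (lau (chi (-m))) y + T.card * D k n i y = 0 := fun y hy => by
    rw [D_eq_zero hk hkn i hy, ord_chi_eq_zero hk hkn hy, mul_zero, add_zero]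
  have hray : ∀ w ∈ vertexSet k n,
      ((ord (lau (chi (-m))) (rayPoint w) + T.card * D k n i (rayPoint w) : ℤ) : ℝ) =
        (if w ∈ E k n i then (T.card : ℝ) else 0) - pairing m (toReal w) := fun w hw => by
    rw [Int.cast_add, ord_chi_rayPoint hk hkn hw, D_rayPoint hk hkn i hw, pairing_neg]
    split_ifs <;> push_cast <;> ring
  have hin : ∀ w ∈ vertexSet k n, toReal w ∈ F.carrier →
      ord (lau (chi (-m))) (rayPoint w) + T.card * D k n i (rayPoint w) = 0 := fun w hw hwF => by
    have := hray w hw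
    rw [(hm w hw).1 hwF, sub_self] at this
    exact_mod_cast this
  have hout : ∀ w ∈ vertexSet k n, toReal w ∉ F.carrier →
      0 < ord (lau (chi (-m))) (rayPoint w) + T.card * D k n i (rayPoint w) := fun w hw hwF => by
    have := sub_pos.2 ((hm w hw).2 hwF rfl)
    rw [← hray w hw] at this
    exact_mod_cast this
  refine ⟨T.card, Finset.card_pos.2 ⟨0, hT0⟩, lau (chi (-m)), lau_chi_ne_zero _, fun y => ?_,
    F.chart.opensRange, ⟨p, rfl⟩, isAffineOpen_opensRange _, fun z => ⟨fun hz y hyz => ?_,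
    fun hz => ?_⟩⟩
  · by_cases hy : ∃ w ∈ vertexSet k n, y = rayPoint w
    · obtain ⟨w, hw, rfl⟩ := hy
      by_cases hwF : toReal w ∈ F.carrier
      · exact (hin w hw hwF).ge
      · exact (hout w hw hwF).le
    · push Not at hy
      exact (hzero y hy).ge
  · obtain ⟨q, rfl⟩ := hz
    obtain ⟨r, rfl⟩ := Face.exists_of_specializes hyz
    by_cases hy : ∃ w ∈ vertexSet k n, F.chart r = rayPoint w
    · obtain ⟨w, hw, hr⟩ := hy
      rw [hr]
      exact hin w hw (mem_of_chart_eq_rayPoint hk hkn hw hr)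
    · push Not at hy
      exact hzero _ hy
  · obtain ⟨G, q, rfl⟩ := Face.exists_chart_eq z
    obtain ⟨r, rfl⟩ := Face.exists_comap_eq (G := G.inter F) Set.inter_subset_left q
      fun w hw hwG hwI => by
        have hwF : toReal w ∉ F.carrier := fun h => hwI ⟨hwG, h⟩
        by_contra! hno
        exact (hout w hw hwF).ne' (hz _ ((rayPoint_specializes_iff hwG q).2 hno))
    rw [Face.chart_comap, ← Face.chart_comap (G := F) (Face.cone_mono Set.inter_subset_right)]
    exact ⟨_, rfl⟩

end GrassmannianToric

/-! ### The divisors of Laurent polynomials -/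

namespace Toric

variable {ι : Type} [Fintype ι]

instance : IsNoetherianRing (TorusRing ι) := Algebra.FiniteType.isNoetherianRing ℂ (TorusRing ι)

end Toric

namespace GrassmannianToric

open Toric DivisorTheory AlgebraicGeometry.Scheme

variable {k n : ℕ}

lemma ord_lau_eq_one {p : PrimeSpectrum (TorusRing (Idx k n))} {t : TorusRing (Idx k n)}
    (ht : t ≠ 0) (hp : p.asIdeal = Ideal.span {t}) : ord (lau t) (torus k n p) = 1 :=
  ord_ratFun_eq_one (torus k n) p ht hp

lemma coheight_torus (p : PrimeSpectrum (TorusRing (Idx k n))) :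
    Order.coheight (torus k n p) = p.asIdeal.height := coheight_chart (torus k n) p

/-- The prime ideals of codimension one of the ring of Laurent polynomials are principal. -/
lemma exists_prime_span_eq {p : PrimeSpectrum (TorusRing (Idx k n))} (hp : p.asIdeal.height = 1) :
    ∃ t, Prime t ∧ p.asIdeal = Ideal.span {t} := by
  have hpp := p.isPrime
  obtain ⟨t, htp, ht⟩ := hpp.exists_mem_prime_of_ne_bot (p.asIdeal.ne_bot_of_height_eq_one hp)
  exact ⟨t, ht, p.asIdeal.eq_span_singleton_of_height_eq_one hp htp ht⟩

/-- A rational function has finitely many zeros and poles on the torus. -/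
lemma finite_ord_torus_ne_zero {f : (P k n).functionField} (hf : f ≠ 0) :
    {p : PrimeSpectrum (TorusRing (Idx k n)) | ord f (torus k n p) ≠ 0}.Finite := by
  obtain ⟨a, b, hb, rfl⟩ := exists_ratFun_div (torus k n) f
  have ha : a ≠ 0 := by
    rintro rfl
    simp at hf
  have key : ∀ {r : TorusRing (Idx k n)}, r ≠ 0 →
      {p : PrimeSpectrum (TorusRing (Idx k n)) | ord (lau r) (torus k n p) ≠ 0}.Finite := by
    intro r hr
    refine Set.Finite.of_finite_image (f := PrimeSpectrum.asIdeal) ?_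
      fun p _ q _ h => PrimeSpectrum.ext h
    refine ((Ideal.span {r}).finite_minimalPrimes_of_isNoetherianRing).subset ?_
    rintro _ ⟨p, hp, rfl⟩
    have hrp : r ∈ p.asIdeal := by
      by_contra h
      exact hp (ord_lau_torus p h)
    have hc : p.asIdeal.height = 1 := by
      rw [← coheight_torus]
      by_contra h
      exact hp (ord_eq_zero_of_coheight_neq_one h _)
    refine ⟨⟨p.isPrime, (Ideal.span_singleton_le_iff_mem _).2 hrp⟩, fun J hJ hJp => ?_⟩
    have hJ1 := hJ.1
    refine (Ideal.eq_of_le_of_height_le J hJp ?_).ge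
    rw [hc, Order.one_le_iff_ne_zero, Ne, Ideal.height_eq_zero_iff,
      IsDomain.minimalPrimes_eq_singleton_bot]
    rintro (h : J = ⊥)
    have := hJ.2 (Ideal.mem_span_singleton_self r)
    rw [h] at this
    exact hr this
  refine ((key ha).union (key hb)).subset fun p hp => ?_
  by_contra hno
  simp only [Set.mem_union, Set.mem_ofPred_eq, not_or, not_not] at hno
  refine hp ?_
  rw [ord_div (ratFun_ne_zero _ ha) (ratFun_ne_zero _ hb)]
  exact sub_eq_zero.2 (hno.1.trans hno.2.symm)

end GrassmannianToric

/-! ### The Picard group -/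

namespace GrassmannianToric

open Toric DivisorTheory AlgebraicGeometry.Scheme

variable {k n : ℕ}

lemma eq_neg_f_of_mem_E (hkn : k < n) (hk : 1 ≤ k) {w : Idx k n → ℤ} (hw : w ∈ E k n n) :
    w = -f k n k (n - k) := by
  rcases hw with ⟨h, -⟩ | ⟨-, h, -⟩ | ⟨j, -, h, h', -⟩ | ⟨-, h⟩
  · omega
  · omega
  · omega
  · exact h

/-- Zero is an interior point of the polytope. -/
lemma eq_zero_of_pairing_nonneg {m : Idx k n → ℤ}
    (h : ∀ w ∈ vertexSet k n, 0 ≤ pairing m (toReal w)) : m = 0 := by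
  have h0 := val_eq_zero (a := fun p => ((-m) p : ℝ)) fun w hw => by
    have := h w hw
    have h1 := pairing_neg m (toReal w)
    rw [pairing_eq_form (-m)] at h1
    linarith
  funext p
  have := congrFun h0 p
  simpa using this

lemma eq_zero_of_pairing_nonpos {m : Idx k n → ℤ}
    (h : ∀ w ∈ vertexSet k n, pairing m (toReal w) ≤ 0) : m = 0 := by
  rw [← neg_eq_zero]
  refine eq_zero_of_pairing_nonneg fun w hw => ?_
  rw [pairing_neg]
  exact neg_nonneg.2 (h w hw)

/-- The vertices outside `E_n` span `N_ℝ`. -/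
lemma eq_zero_of_pairing_eq_zero (hk : 1 ≤ k) (hkn : k < n) {m : Idx k n → ℤ}
    (h : ∀ w ∈ vertexSet k n, w ∉ E k n n → pairing m (toReal w) = 0) : m = 0 := by
  rcases le_total 0 (pairing m (toReal (-f k n k (n - k)))) with h1 | h1
  · refine eq_zero_of_pairing_nonneg fun w hw => ?_
    by_cases hwn : w ∈ E k n n
    · rwa [eq_neg_f_of_mem_E hkn hk hwn]
    · exact (h w hw hwn).ge
  · refine eq_zero_of_pairing_nonpos fun w hw => ?_
    by_cases hwn : w ∈ E k n n
    · rwa [eq_neg_f_of_mem_E hkn hk hwn]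
    · exact (h w hw hwn).le

/-- A Laurent polynomial without zeros of codimension one on the torus is a unit. -/
lemma isUnit_of_forall_prime_not_dvd {a : TorusRing (Idx k n)} (ha : a ≠ 0)
    (h : ∀ t, Prime t → ¬ t ∣ a) : IsUnit a := by
  by_contra hu
  obtain ⟨t, ht, hta⟩ := WfDvdMonoid.exists_irreducible_factor hu ha
  exact h t ht.prime hta

/-- The point of codimension one of the torus given by a prime element. -/
def primePoint {t : TorusRing (Idx k n)} (ht : Prime t) : PrimeSpectrum (TorusRing (Idx k n)) :=
  ⟨Ideal.span {t}, (Ideal.span_singleton_prime ht.ne_zero).2 ht⟩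

lemma ord_lau_primePoint_ne_zero {t a : TorusRing (Idx k n)} (ht : Prime t) (ha : a ≠ 0)
    (h : t ∣ a) : ord (lau a) (torus k n (primePoint ht)) ≠ 0 := by
  have hfin : FiniteMultiplicity t a := FiniteMultiplicity.of_not_isUnit ht.not_isUnit ha
  obtain ⟨c, hc, hc'⟩ := hfin.exists_eq_pow_mul_and_not_dvd
  have he : multiplicity t a ≠ 0 := multiplicity_ne_zero.2 h
  have hc0 : c ≠ 0 := by
    rintro rfl
    exact hc' (dvd_zero t)
  have h1 : ord (lau c) (torus k n (primePoint ht)) = 0 :=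
    ord_lau_torus _ fun hmem => hc' (Ideal.mem_span_singleton.1 hmem)
  have h2 : ord (lau t) (torus k n (primePoint ht)) = 1 := ord_lau_eq_one ht.ne_zero rfl
  have ht0 : lau t ≠ 0 := (map_ne_zero_iff _ lau_injective).2 ht.ne_zero
  have hc0' : lau c ≠ 0 := (map_ne_zero_iff _ lau_injective).2 hc0
  rw [hc, map_mul, map_pow, ord_mul (pow_ne_zero _ ht0) hc0', h1, ← zpow_natCast, ord_zpow ht0, h2]
  omega

/-- A rational function without zeros and poles on the torus is a monomial. -/
lemma exists_eq_single_of_ord_torus {f : (P k n).functionField} (hf : f ≠ 0)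
    (h : ∀ p, ord f (torus k n p) = 0) :
    ∃ (m : Idx k n → ℤ) (c : ℂ), c ≠ 0 ∧ f = lau (AddMonoidAlgebra.single m c) := by
  obtain ⟨a, b, hb, rfl⟩ := exists_ratFun_div (torus k n) f
  change TorusRing (Idx k n) at a b
  obtain ⟨b', a', c, hrel, rfl, rfl⟩ := UniqueFactorizationMonoid.exists_reduced_factors b hb a
  have hb' := right_ne_zero_of_mul hb
  have hc := left_ne_zero_of_mul hb
  have hf' : ratFun (torus k n) (c * a') / ratFun (torus k n) (c * b') = lau a' / lau b' := by
    change lau (c * a') / lau (c * b') = _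
    rw [map_mul, map_mul, mul_div_mul_left _ _ ((map_ne_zero_iff _ lau_injective).2 hc)]
  rw [hf'] at hf h ⊢
  have ha' : a' ≠ 0 := by
    rintro rfl
    simp at hf
  have hla : lau a' ≠ 0 := (map_ne_zero_iff _ lau_injective).2 ha'
  have hlb : lau b' ≠ 0 := (map_ne_zero_iff _ lau_injective).2 hb'
  have key : ∀ p, ord (lau a') (torus k n p) = ord (lau b') (torus k n p) := fun p => by
    have := h p
    rwa [ord_div hla hlb, sub_eq_zero] at this
  have hz : ∀ {t : TorusRing (Idx k n)} (ht : Prime t) {r : TorusRing (Idx k n)}, ¬ t ∣ r →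
      ord (lau r) (torus k n (primePoint ht)) = 0 := fun ht r hr =>
    ord_lau_torus _ fun hmem => hr (Ideal.mem_span_singleton.1 hmem)
  have hua : IsUnit a' := isUnit_of_forall_prime_not_dvd ha' fun t ht hta =>
    ord_lau_primePoint_ne_zero ht ha' hta
      ((key _).trans (hz ht fun htb => ht.not_isUnit (hrel htb hta)))
  have hub : IsUnit b' := isUnit_of_forall_prime_not_dvd hb' fun t ht htb =>
    ord_lau_primePoint_ne_zero ht hb' htb
      ((key _).symm.trans (hz ht fun hta => ht.not_isUnit (hrel htb hta)))
  obtain ⟨b'', hbb⟩ := hub.exists_right_inv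
  have hu : IsUnit (a' * b'') := hua.mul (IsUnit.of_mul_eq_one _ ((mul_comm _ _).trans hbb))
  obtain ⟨m, c, hc, hm⟩ := exists_eq_single_of_isUnit hu
  refine ⟨m, c, hc, ?_⟩
  rw [← hm, div_eq_iff hlb, ← map_mul, mul_assoc, mul_comm b'', hbb, mul_one]

lemma ord_single_rayPoint (hk : 1 ≤ k) (hkn : k < n) {w : Idx k n → ℤ} (hw : w ∈ vertexSet k n)
    (m : Idx k n → ℤ) {c : ℂ} (hc : c ≠ 0) :
    (ord (lau (AddMonoidAlgebra.single m c)) (rayPoint w) : ℝ) = pairing m (toReal w) := by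
  obtain ⟨F, hF⟩ := exists_face_of_vertex hk hkn hw
  have hwF : toReal w ∈ F.carrier := (hF w hw).2 rfl
  have hs : (AddMonoidAlgebra.single m c : TorusRing (Idx k n)) =
      toTorus F.cone.1 (AddMonoidAlgebra.single 0 c) * chi m := by
    rw [toTorus_single, chi, AddMonoidAlgebra.single_mul_single, mul_one]
    congr 1
    exact (zero_add m).symm
  have hu : IsUnit (AddMonoidAlgebra.single 0 c : chartRing F.cone.1) := by
    refine IsUnit.of_mul_eq_one (AddMonoidAlgebra.single 0 c⁻¹) ?_
    rw [AddMonoidAlgebra.single_mul_single, mul_inv_cancel₀ hc, add_zero]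
    rfl
  have h0 : ord (lau (toTorus F.cone.1 (AddMonoidAlgebra.single 0 c))) (rayPoint w) = 0 := by
    rw [lau_toTorus, rayPoint_eq_chart hwF]
    exact ord_ratFun_eq_zero F.chart _ fun hmem =>
      (facePrime (toReal w) (Face.mem_cone hwF)).isPrime.ne_top
        (Ideal.eq_top_of_isUnit_mem _ hmem hu)
  have hne : lau (toTorus F.cone.1 (AddMonoidAlgebra.single 0 c)) ≠ 0 :=
    (map_ne_zero_iff _ lau_injective).2 (hu.map (toTorus F.cone.1)).ne_zero
  rw [hs, map_mul, ord_mul hne (lau_chi_ne_zero m), h0, zero_add]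
  exact ord_chi_rayPoint hk hkn hw m

lemma torus_ne_rayPoint (hk : 1 ≤ k) (hkn : k < n) {w : Idx k n → ℤ} (hw : w ∈ vertexSet k n)
    (p : PrimeSpectrum (TorusRing (Idx k n))) : torus k n p ≠ rayPoint w := fun h => by
  have := mem_of_chart_eq_rayPoint hk hkn hw (G := Face.empty)
    (q := Spec.map (CommRingCat.ofHom (toTorus (Face.empty : Face k n).cone.1)) p) h
  exact this

lemma zsmul_D_apply (t : ℤ) (i : ℕ) (y : P k n) : (t • D k n i) y = t * D k n i y := rfl

/-- The divisor `D(E_i)` has infinite order in the class group: a function whose divisor is a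
multiple of it is a monomial, whose exponent pairs with all vertices with the same sign. -/
lemma eq_zero_of_zsmul_D_mem (hk : 1 ≤ k) (hkn : k < n) {i : ℕ} (hi : 1 ≤ i) (hin : i ≤ n) {t : ℤ}
    (h : t • D k n i ∈ principalDivisors (P k n)) : t = 0 := by
  classical
  obtain ⟨f, hf, hD⟩ := h
  obtain ⟨m, c, hc, rfl⟩ := exists_eq_single_of_ord_torus hf fun p => by
    rw [← hD, zsmul_D_apply,
      D_eq_zero hk hkn i fun w hw => torus_ne_rayPoint hk hkn hw p, mul_zero]
  have hm : ∀ w ∈ vertexSet k n, pairing m (toReal w) = t * if w ∈ E k n i then 1 else 0 :=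
    fun w hw => by
      rw [← ord_single_rayPoint hk hkn hw m hc, ← hD, zsmul_D_apply, D_rayPoint hk hkn i hw]
      push_cast
      rfl
  have h0 : m = 0 := by
    rcases le_total 0 t with ht | ht
    · refine eq_zero_of_pairing_nonneg fun w hw => ?_
      rw [hm w hw]
      exact mul_nonneg (by exact_mod_cast ht) (by split_ifs <;> norm_num)
    · refine eq_zero_of_pairing_nonpos fun w hw => ?_
      rw [hm w hw]
      exact mul_nonpos_of_nonpos_of_nonneg (by exact_mod_cast ht) (by split_ifs <;> norm_num)
  obtain ⟨w, hw⟩ := E_nonempty hk hkn hi hin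
  have := hm w (E_subset i hw)
  rw [h0, pairing_zero, if_pos hw, mul_one] at this
  exact_mod_cast this.symm

lemma pairing_sum {α : Type*} (s : Finset α) (x : α → Idx k n → ℝ) (m : Idx k n → ℤ) :
    pairing m (∑ a ∈ s, x a) = ∑ a ∈ s, pairing m (x a) := by
  simp only [pairing, Finset.sum_apply, Finset.mul_sum]
  exact Finset.sum_comm

/-- There is an affine chart with a torus fixed point, the point of the given prime ideal, that
contains the generic points of all invariant divisors except the one in `E_n`. -/
lemma exists_fixedPoint (hk : 1 ≤ k) (hkn : k < n) :
    ∃ (F : Face k n) (p₀ : PrimeSpectrum (chartRing F.cone.1)),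
      (∀ w ∈ vertexSet k n, toReal w ∈ F.carrier ↔ w ∉ E k n n) ∧
      (∀ w ∈ vertexSet k n, w ∉ E k n n → rayPoint w ⤳ F.chart p₀) ∧
      ∀ r : chartRing F.cone.1, r ∉ p₀.asIdeal → r.coeff 0 ≠ 0 := by
  classical
  obtain ⟨Φ, hΦ, hne, hmem⟩ := exists_bigFace hk hkn
  let F : Face k n := ⟨Φ, hΦ, hne⟩
  let W := vertexSet_finite.toFinset.filter fun w : Idx k n → ℤ => toReal w ∈ F.carrier
  have hW : ∀ w, w ∈ W ↔ w ∈ vertexSet k n ∧ toReal w ∈ F.carrier := fun w => by simp [W]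
  have hx : ∑ w ∈ W, toReal w ∈ F.cone.1 :=
    Submodule.sum_mem _ fun w hw => Face.mem_cone ((hW w).1 hw).2
  refine ⟨F, facePrime _ hx, hmem, fun w hw hwn => ?_, fun r hr hr0 => hr fun m hm => ?_⟩
  · have hwF : toReal w ∈ F.carrier := (hmem w hw).2 hwn
    refine (rayPoint_specializes_iff hwF _).2 fun m hm hpos => (chr_mem_facePrime hm).2 ?_
    rw [pairing_sum]
    exact hpos.trans_le (Finset.single_le_sum (f := fun w => pairing m (toReal w))
      (fun v hv => hm _ (Face.mem_cone ((hW v).1 hv).2)) ((hW w).2 ⟨hw, hwF⟩))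
  · by_contra hle
    rw [pairing_sum] at hle
    have hnn : ∀ w ∈ W, 0 ≤ pairing m.1 (toReal w) := fun v hv =>
      m.2 _ (Face.mem_cone ((hW v).1 hv).2)
    have hz := (Finset.sum_eq_zero_iff_of_nonneg hnn).1
      (le_antisymm (not_lt.1 hle) (Finset.sum_nonneg hnn))
    have hm0 : m.1 = 0 := eq_zero_of_pairing_eq_zero hk hkn fun w hw hwn =>
      hz w ((hW w).2 ⟨hw, (hmem w hw).2 hwn⟩)
    have : m = 0 := Subtype.ext hm0
    rw [this] at hm
    exact hm hr0

/-- A prime divisor of the torus whose closure avoids the fixed point of an affine chart has an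
equation that is regular on the chart and does not vanish at the fixed point. -/
lemma exists_equation {F : Face k n} {p₀ : PrimeSpectrum (chartRing F.cone.1)}
    (hp₀ : ∀ r : chartRing F.cone.1, r ∉ p₀.asIdeal → r.coeff 0 ≠ 0)
    {p : PrimeSpectrum (TorusRing (Idx k n))} (hp : p.asIdeal.height = 1)
    (hsp : ¬ torus k n p ⤳ F.chart p₀) :
    ∃ f : (P k n).functionField, f ≠ 0 ∧ ord f (torus k n p) = 1 ∧
      (∀ q : PrimeSpectrum (TorusRing (Idx k n)), q.asIdeal.height = 1 → q ≠ p →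
        ord f (torus k n q) = 0) ∧
      ∀ w, toReal w ∈ F.carrier → ord f (rayPoint w) = 0 := by
  have hy : F.chart (PrimeSpectrum.comap (toTorus F.cone.1) p) = torus k n p :=
    congr($(toTorus_chart F) p)
  rw [← hy, Face.chart_specializes_iff, SetLike.not_le_iff_exists] at hsp
  obtain ⟨s, hsp, hs⟩ := hsp
  obtain ⟨t, ht, htp⟩ := exists_prime_span_eq hp
  have hsp' : toTorus F.cone.1 s ∈ p.asIdeal := hsp
  rw [htp] at hsp'
  obtain ⟨u, hu⟩ := Ideal.mem_span_singleton.1 hsp'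
  obtain ⟨a, r, hr, hr0⟩ := exists_toTorus_eq_mul_chi hu (hp₀ s hs)
  have htne : lau t ≠ 0 := (map_ne_zero_iff _ lau_injective).2 ht.ne_zero
  have hord : ∀ q : PrimeSpectrum (TorusRing (Idx k n)),
      ord (lau (toTorus F.cone.1 r)) (torus k n q) = ord (lau t) (torus k n q) :=
    fun q => by
      have h1 := ord_mul (x := torus k n q) htne (lau_chi_ne_zero a)
      rwa [ord_chi_torus, add_zero, ← map_mul, ← hr] at h1
  refine ⟨lau (toTorus F.cone.1 r), ?_, ?_, fun q hq hqp => ?_, fun w hwF => ?_⟩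
  · rw [hr, map_mul]
    exact mul_ne_zero htne (lau_chi_ne_zero a)
  · exact (hord p).trans (ord_lau_eq_one ht.ne_zero htp)
  · refine (hord q).trans (ord_lau_torus q fun htq => hqp (PrimeSpectrum.ext ?_))
    have := q.isPrime
    rw [q.asIdeal.eq_span_singleton_of_height_eq_one hq htq ht, htp]
  · rw [lau_toTorus, rayPoint_eq_chart hwF]
    refine ord_ratFun_eq_zero F.chart _ fun hmem => ?_
    have := hmem 0 hr0
    have h0 : pairing (0 : dualMonoid F.cone.1).1 (toReal w) = 0 := pairing_zero _
    rw [h0] at this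
    exact lt_irrefl _ this

lemma apply_eq_zero_of_coheight_ne_one {D' : AlgebraicCycle (P k n) ℤ}
    (hD' : D' ∈ cartierDivisors (P k n)) {y : P k n} (hy : Order.coheight y ≠ 1) : D' y = 0 := by
  obtain ⟨U, hU, f, -, h⟩ := hD' y
  rw [h y hU, ord_eq_zero_of_coheight_neq_one hy]

/-- Every Cartier divisor is linearly equivalent to a multiple of `D(E_n)`: it is principal near the
fixed point of a chart that meets all invariant divisors but `D(E_n)`, and after subtracting a
principal divisor and the prime divisors that avoid the fixed point, only `D(E_n)` remains. -/
lemma exists_sub_zsmul_D_mem (hk : 1 ≤ k) (hkn : k < n) {D' : AlgebraicCycle (P k n) ℤ}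
    (hD' : D' ∈ cartierDivisors (P k n)) :
    ∃ t : ℤ, D' - t • D k n n ∈ principalDivisors (P k n) := by
  classical
  obtain ⟨F, p₀, hF, hray, hp₀⟩ := exists_fixedPoint hk hkn
  obtain ⟨V, hV, g, hg, hDg⟩ := hD' (F.chart p₀)
  have hsp : ∀ y, y ⤳ F.chart p₀ → D' y = ord g y := fun y hy =>
    hDg y (hy.mem_open V.isOpen hV)
  -- the prime divisors of the torus at which `D' - div g` is not zero avoid the fixed point
  let S : Set (PrimeSpectrum (TorusRing (Idx k n))) := {p | D' (torus k n p) ≠ ord g (torus k n p)}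
  have hS : S.Finite := by
    have h1 : (Function.support D').Finite := by
      have := (Function.locallyFinsupp.locallyFiniteSupport D').finite_inter_support_of_isCompact
        isCompact_univ
      rwa [Set.univ_inter] at this
    have h2 : (torus k n ⁻¹' Function.support D').Finite :=
      h1.preimage (torus k n).isOpenEmbedding.injective.injOn
    refine (h2.union (finite_ord_torus_ne_zero hg)).subset fun p hp => ?_
    by_cases hp1 : D' (torus k n p) = 0
    · exact Or.inr fun hp2 => hp (hp1.trans hp2.symm)
    · exact Or.inl hp1
  have hSc : ∀ p ∈ S, p.asIdeal.height = 1 := fun p hp => by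
    rw [← coheight_torus]
    by_contra hc
    refine hp ?_
    rw [apply_eq_zero_of_coheight_ne_one hD' hc, ord_eq_zero_of_coheight_neq_one hc]
  have hex : ∀ p : S, _ := fun p => exists_equation hp₀ (hSc p.1 p.2) fun h => p.2 (hsp _ h)
  choose e he0 he1 he2 he3 using hex
  have := hS.fintype
  let a : S → ℤ := fun p => D' (torus k n p.1) - ord g (torus k n p.1)
  let h : (P k n).functionField := ∏ p : S, e p ^ a p
  have hz : ∀ p ∈ Finset.univ, e p ^ a p ≠ 0 := fun p _ => zpow_ne_zero _ (he0 p)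
  have hh0 : h ≠ 0 := Finset.prod_ne_zero_iff.2 hz
  have hh : ∀ y, ord h y = ∑ p : S, a p * ord (e p) y := fun y => by
    rw [ord_prod _ _ hz]
    exact Finset.sum_congr rfl fun p _ => ord_zpow (he0 p) y _
  have htorus : ∀ q, q.asIdeal.height = 1 → ord (g * h) (torus k n q) = D' (torus k n q) := by
    intro q hq
    rw [ord_mul hg hh0, hh]
    by_cases hqS : q ∈ S
    · rw [Finset.sum_eq_single ⟨q, hqS⟩, he1, mul_one]
      · simp only [a]
        ring
      · intro p _ hpq
        rw [he2 p q hq fun h => hpq (Subtype.ext h.symm), mul_zero]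
      · simp
    · rw [Finset.sum_eq_zero, add_zero]
      · exact (not_not.1 hqS).symm
      · intro p _
        rw [he2 p q hq fun h => hqS (h ▸ p.2), mul_zero]
  have hrays : ∀ w ∈ vertexSet k n, w ∉ E k n n → ord (g * h) (rayPoint w) = D' (rayPoint w) := by
    intro w hw hwn
    rw [ord_mul hg hh0, hh, Finset.sum_eq_zero fun p _ => by
      rw [he3 p w ((hF w hw).2 hwn), mul_zero], add_zero, hsp _ (hray w hw hwn)]
  -- the remaining coefficient is the one at the only element of `E_n`
  let y₀ : P k n := rayPoint (-f k n k (n - k))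
  refine ⟨D' y₀ - ord (g * h) y₀, g * h, mul_ne_zero hg hh0, fun y => ?_⟩
  change D' y - _ * D k n n y = _
  by_cases hc : Order.coheight y = 1
  · rcases exists_torus_eq_or_eq_rayPoint hk hkn hc with ⟨q, rfl⟩ | ⟨w, hw, rfl⟩
    · rw [D_eq_zero hk hkn n fun w hw => torus_ne_rayPoint hk hkn hw q, mul_zero, sub_zero,
        htorus q ((coheight_torus q).symm.trans hc)]
    · rw [D_rayPoint hk hkn n hw]
      split_ifs with hwn
      · rw [eq_neg_f_of_mem_E hkn hk hwn]
        simp only [y₀]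
        ring
      · rw [mul_zero, sub_zero, hrays w hw hwn]
  · rw [apply_eq_zero_of_coheight_ne_one hD' hc, ord_eq_zero_of_coheight_neq_one hc,
      D_eq_zero hk hkn n (y := y) fun w hw h => hc (by rw [h]; exact coheight_rayPoint hk hkn hw),
      mul_zero, sub_zero]

/-- The class of `D(E_i)` is a free generator of the Picard group. -/
lemma bijective_zsmul_cls (hk : 1 ≤ k) (hkn : k < n) {i : ℕ} (hi : 1 ≤ i) (hin : i ≤ n) :
    Function.Bijective fun m : ℤ =>
      m • Pic.cls ⟨D k n i, D_mem_cartierDivisors hk hkn hi hin⟩ := by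
  constructor
  · intro a b hab
    have h : (a - b) • Pic.cls ⟨D k n i, D_mem_cartierDivisors hk hkn hi hin⟩ = 0 := by
      rw [sub_zsmul]
      exact sub_eq_zero.2 hab
    have h' := (QuotientAddGroup.eq_zero_iff
      ((a - b) • (⟨D k n i, D_mem_cartierDivisors hk hkn hi hin⟩ : cartierDivisors (P k n)))).1 h
    exact sub_eq_zero.1 (eq_zero_of_zsmul_D_mem hk hkn hi hin h')
  · intro c
    obtain ⟨⟨D', hD'⟩, rfl⟩ := QuotientAddGroup.mk_surjective c
    obtain ⟨t, ht⟩ := exists_sub_zsmul_D_mem hk hkn hD'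
    refine ⟨t, QuotientAddGroup.eq.2 ?_⟩
    change -(t • D k n i) + D' ∈ principalDivisors (P k n)
    have h := add_mem ht (zsmul_mem
      (D_sub_D_mem_principalDivisors hk hkn (hi.trans hin) le_rfl hi hin) t)
    rw [zsmul_sub] at h
    convert h using 1
    abel

end GrassmannianToric

end

theorem mainTheorem4 (k n : ℕ) (hk : 1 ≤ k) (hkn : k < n) :
    ∃ (_ : IsIntegral (GrassmannianToric.P k n))
      (_ : IsLocallyNoetherian (GrassmannianToric.P k n)),
      (∀ i ∈ Finset.Icc 1 n,
        ∃ hD : GrassmannianToric.D k n i ∈ DivisorTheory.cartierDivisors (GrassmannianToric.P k n),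
          DivisorTheory.IsAmple ⟨GrassmannianToric.D k n i, hD⟩ ∧
          Function.Bijective (fun m : ℤ =>
            m • DivisorTheory.Pic.cls ⟨GrassmannianToric.D k n i, hD⟩)) ∧
      (∀ i ∈ Finset.Icc 1 n, ∀ j ∈ Finset.Icc 1 n, DivisorTheory.LinearlyEquivalent
        (GrassmannianToric.D k n i) (GrassmannianToric.D k n j)) := by
  refine ⟨inferInstance, inferInstance, fun i hi => ?_, fun i hi j hj => ?_⟩
  · obtain ⟨hi, hin⟩ := Finset.mem_Icc.1 hi
    exact ⟨GrassmannianToric.D_mem_cartierDivisors hk hkn hi hin,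
      GrassmannianToric.isAmple_D hk hkn hi hin,
      GrassmannianToric.bijective_zsmul_cls hk hkn hi hin⟩
  · obtain ⟨hi, hin⟩ := Finset.mem_Icc.1 hi
    obtain ⟨hj, hjn⟩ := Finset.mem_Icc.1 hj
    exact GrassmannianToric.D_sub_D_mem_principalDivisors hk hkn hi hin hj hjn
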